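/- Let $(M,g)$ be a connected smooth Lorentzian manifold (Hausdorff, second countable, signature $(-,+,\dots,+)$) of dimension $n+1\ge 2$. Definitions. A smooth embedded hypersurface of $M$ is null if the metric induced on each of its tangent spaces is degenerate. A smooth embedded null hypersurface $\mathcal H_\xi$ is a Killing horizon of the Killing vector field $\xi$ if $\xi$ is null on $\mathcal H_\xi$, nowhere zero on $\mathcal H_\xi$ and tangent to $\mathcal H_\xi$, and if either $\mathcal H_\xi$ is connected (and non-empty) or the interior of its closure, i.e. the set of points near which $\overline{\mathcal H_\xi}$ is a smooth embedded hypersurface without boundary, is connected (and non-empty). Its surface gravity $\kappa_\xi:\mathcal H_\xi\to\mathbb R$ is defined by $\operatorname{grad}(g(\xi,\xi))=-2\kappa_\xi\,\xi$ on $\mathcal H_\xi$ (equivalently $\nabla_\xi\xi=\kappa_\xi\xi$); $\mathcal H_\xi$ is degenerate if $\kappa_\xi=0$. An embedded null hypersurface $\mathcal H$ is a multiple Killing horizon (MKH) if there are at least two linearly independent Killing vector fields $\xi_1,\dots,\xi_k$, $k\ge 2$, with Killing horizons $\mathcal H_{\xi_i}$ such that $\overline{\mathcal H_{\xi_i}}=\overline{\mathcal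 H}$ for all $i$. Let $\mathcal A_{\mathcal H}$ be the set consisting of the zero field and of all Killing vector fields $\xi$ admitting a Killing horizon $\mathcal H_\xi$ with $\overline{\mathcal H_\xi}=\overline{\mathcal H}$, and let $\mathcal A_{\mathcal H}^{deg}\subseteq\mathcal A_{\mathcal H}$ consist of the zero field and of those $\xi$ admitting such a horizon that is degenerate. Theorem. Let $\mathcal H$ be an MKH in $(M,g)$. Then $\mathcal A_{\mathcal H}$ is a Lie subalgebra of the Lie algebra of smooth vector fields on $M$, of finite dimension $m\ge 2$ (the order of $\mathcal H$). There is a linear map $\kappa:\mathcal A_{\mathcal H}\to\mathbb R$, $\zeta\mapsto\kappa_\zeta$, such that for each nonzero $\zeta\in\mathcal A_{\mathcal H}$ the surface gravity of $\zeta$ on every Killing horizon of $\zeta$ with closure $\overline{\mathcal H}$ is the constant $\kappa_\zeta$. Moreover: 1. $\mathcal A_{\mathcal H}^{deg}=\{\zeta\in\mathcal A_{\mathcal H}:\kappa_\zeta=0\}$, and it is an Abelian Lie subalgebra of $\mathcal A_{\mathcal H}$ of dimension at least $m-1$. 2. If $\dim\mathcal A_{\mathcal H}^{deg}=m-1$,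 then $\mathcal A_{\mathcal H}\setminus\mathcal A_{\mathcal H}^{deg}$ is non-empty, and every $\xi$ in it satisfies $\kappa_\xi\ne 0$ and $[\xi,\eta]=-\kappa_\xi\,\eta$ for all $\eta\in\mathcal A_{\mathcal H}^{deg}$. 3. The nonzero surface gravity, if there is one, is essentially unique: if $\xi\in\mathcal A_{\mathcal H}$ has $\kappa_\xi\neq0$, then for every $\zeta\in\mathcal A_{\mathcal H}$ there is exactly one $c\in\mathbb R$ such that both $\zeta-c\,\xi\in\mathcal A_{\mathcal H}^{deg}$ and $\kappa_\zeta=c\,\kappa_\xi$. -/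

import Mathlib

open Set
open scoped Manifold ContDiff Bundle

/-- The Lie algebra `𝔛(M)` of smooth vector fields on a manifold `M` of dimension `n + 1`. -/
abbrev SmoothVF (n : ℕ) (M : Type*) [TopologicalSpace M]
    [ChartedSpace (EuclideanSpace ℝ (Fin (n + 1))) M] [IsManifold (𝓡 (n + 1)) ∞ M] : Type _ :=
  Cₛ^∞⟮𝓡 (n + 1); EuclideanSpace ℝ (Fin (n + 1)),
    (TangentSpace (𝓡 (n + 1)) : M → Type _)⟯

namespace SmoothVF

variable {n : ℕ} {M : Type*} [TopologicalSpace M]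
  [ChartedSpace (EuclideanSpace ℝ (Fin (n + 1))) M] [IsManifold (𝓡 (n + 1)) ∞ M]

/-- The Lie bracket of vector fields, `[X, Y] f = X (Y f) - Y (X f)`. -/
noncomputable instance instBracket : Bracket (SmoothVF n M) (SmoothVF n M) where
  bracket X Y := ⟨VectorField.mlieBracket (𝓡 (n + 1)) X Y, by
    have : IsManifold (𝓡 (n + 1)) ((⊤ : ℕ∞) + 1) M := by
      simpa using (inferInstance : IsManifold (𝓡 (n + 1)) ∞ M)
    have : IsManifold (𝓡 (n + 1)) (minSmoothness ℝ 2) M := by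
      rw [minSmoothness_of_isRCLikeNormedField]; infer_instance
    exact ContDiff.mlieBracket_vectorField (n := ⊤) (m := ⊤) X.contMDiff Y.contMDiff (by simp)⟩

theorem coe_bracket (X Y : SmoothVF n M) :
    ⇑⁅X, Y⁆ = VectorField.mlieBracket (𝓡 (n + 1)) X Y := rfl

noncomputable instance instLieRing : LieRing (SmoothVF n M) where
  add_lie X Y Z := by
    ext x
    simp only [coe_bracket, ContMDiffSection.coe_add, Pi.add_apply]
    exact VectorField.mlieBracket_add_left X.mdifferentiableAt Y.mdifferentiableAt
  lie_add X Y Z := by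
    ext x
    simp only [coe_bracket, ContMDiffSection.coe_add, Pi.add_apply]
    exact VectorField.mlieBracket_add_right Y.mdifferentiableAt Z.mdifferentiableAt
  lie_self X := by
    ext x
    simp [coe_bracket]
  leibniz_lie X Y Z := by
    have h3 : IsManifold (𝓡 (n + 1)) (minSmoothness ℝ 3) M := by
      rw [minSmoothness_of_isRCLikeNormedField]; infer_instance
    have h2 : minSmoothness ℝ 2 ≤ (∞ : WithTop ℕ∞) := by
      rw [minSmoothness_of_isRCLikeNormedField]; 
      exact WithTop.coe_le_coe.2 (le_top : (2 : ℕ∞) ≤ ⊤)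
    ext x
    simp only [coe_bracket, ContMDiffSection.coe_add, Pi.add_apply]
    exact VectorField.leibniz_identity_mlieBracket_apply
      ((X.contMDiff x).of_le h2) ((Y.contMDiff x).of_le h2) ((Z.contMDiff x).of_le h2)

noncomputable instance instLieAlgebra : LieAlgebra ℝ (SmoothVF n M) where
  lie_smul c X Y := by
    ext x
    simp only [coe_bracket, ContMDiffSection.coe_smul, Pi.smul_apply]
    exact VectorField.mlieBracket_const_smul_right Y.mdifferentiableAt

end SmoothVF

section Hypersurface

variable {n : ℕ} {M : Type*} [TopologicalSpace M]
  [ChartedSpace (EuclideanSpace ℝ (Fin (n + 1))) M]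

/-- `f` is a smooth defining function, with nowhere vanishing differential on the open set `U`,
of the part of `S` that lies in `U`. -/
def IsDefiningFunction (S U : Set M) (f : M → ℝ) : Prop :=
  IsOpen U ∧ ContMDiffOn (𝓡 (n + 1)) 𝓘(ℝ, ℝ) ∞ f U ∧
    (∀ q ∈ U, mvfderiv (𝓡 (n + 1)) f q ≠ 0) ∧ ∀ q ∈ U, q ∈ S ↔ f q = 0

variable (n) in
/-- The set of points of `C` near which `C` is a smooth embedded hypersurface without boundary.
For the closure of a hypersurface, this is its interior as a hypersurface. -/
def hypersurfaceInterior (C : Set M) : Set M :=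
  {p | p ∈ C ∧ ∃ (U : Set M) (f : M → ℝ), p ∈ U ∧ IsDefiningFunction (n := n) C U f}

variable (n) in
/-- `S` is a smooth embedded hypersurface (without boundary) of `M`. -/
def IsEmbeddedHypersurface (S : Set M) : Prop :=
  ∀ p ∈ S, ∃ (U : Set M) (f : M → ℝ), p ∈ U ∧ IsDefiningFunction (n := n) S U f

/-- A vector `v` at a point `p` of the embedded hypersurface `S` is tangent to `S`:
it is annihilated by the differentials of the local defining functions of `S` at `p`. -/
def IsTangentTo (S : Set M) (p : M) (v : TangentSpace (𝓡 (n + 1)) p) : Prop :=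
  ∀ (U : Set M) (f : M → ℝ), p ∈ U → IsDefiningFunction (n := n) S U f →
    mvfderiv (𝓡 (n + 1)) f p v = 0

end Hypersurface

/-- A smooth metric of signature `(-,+,…,+)` on a manifold `M` of dimension `n + 1`. -/
structure LorentzianMetric (n : ℕ) (M : Type*) [TopologicalSpace M]
    [ChartedSpace (EuclideanSpace ℝ (Fin (n + 1))) M] [IsManifold (𝓡 (n + 1)) ∞ M] where
  /-- the scalar product on each tangent space -/
  inner (p : M) : TangentSpace (𝓡 (n + 1)) p →L[ℝ] TangentSpace (𝓡 (n + 1)) p →L[ℝ] ℝ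
  symm (p : M) (v w : TangentSpace (𝓡 (n + 1)) p) : inner p v w = inner p w v
  signature (p : M) : ∃ b : Module.Basis (Fin (n + 1)) ℝ (TangentSpace (𝓡 (n + 1)) p),
    ∀ i j, inner p (b i) (b j) = if i = j then (if i = 0 then -1 else 1) else 0
  contMDiff : ContMDiff (𝓡 (n + 1)) ((𝓡 (n + 1)).prod
    𝓘(ℝ, EuclideanSpace ℝ (Fin (n + 1)) →L[ℝ] EuclideanSpace ℝ (Fin (n + 1)) →L[ℝ] ℝ)) ∞
    (fun p ↦ Bundle.TotalSpace.mk'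
      (EuclideanSpace ℝ (Fin (n + 1)) →L[ℝ] EuclideanSpace ℝ (Fin (n + 1)) →L[ℝ] ℝ) p (inner p))

namespace LorentzianMetric

variable {n : ℕ} {M : Type*} [TopologicalSpace M]
  [ChartedSpace (EuclideanSpace ℝ (Fin (n + 1))) M] [IsManifold (𝓡 (n + 1)) ∞ M]

/-- The function `g(X, Y)`. -/
noncomputable def pairing (g : LorentzianMetric n M) (X Y : SmoothVF n M) : M → ℝ :=
  fun p ↦ g.inner p (X p) (Y p)

/-- `ξ` is a Killing vector field: `(𝓛_ξ g)(X, Y) = ξ (g(X, Y)) - g([ξ, X], Y) - g(X, [ξ, Y]) = 0`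
for all smooth vector fields `X`, `Y`. -/
def IsKilling (g : LorentzianMetric n M) (ξ : SmoothVF n M) : Prop :=
  ∀ (X Y : SmoothVF n M) (p : M),
    mvfderiv (𝓡 (n + 1)) (g.pairing X Y) p (ξ p)
      - g.pairing ⁅ξ, X⁆ Y p - g.pairing X ⁅ξ, Y⁆ p = 0

/-- `S` is a smooth embedded null hypersurface: the metric induced on each of its tangent spaces
is degenerate. -/
def IsNullHypersurface (g : LorentzianMetric n M) (S : Set M) : Prop :=
  IsEmbeddedHypersurface n S ∧
    ∀ p ∈ S, ∃ k : TangentSpace (𝓡 (n + 1)) p, k ≠ 0 ∧ IsTangentTo S p k ∧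
      ∀ v : TangentSpace (𝓡 (n + 1)) p, IsTangentTo S p v → g.inner p k v = 0

/-- `S` is a Killing horizon of the Killing vector `ξ`. -/
structure IsKillingHorizon (g : LorentzianMetric n M) (ξ : SmoothVF n M) (S : Set M) :
    Prop where
  killing : g.IsKilling ξ
  nullHypersurface : g.IsNullHypersurface S
  null : ∀ p ∈ S, g.inner p (ξ p) (ξ p) = 0
  ne_zero : ∀ p ∈ S, ξ p ≠ 0
  tangent : ∀ p ∈ S, IsTangentTo S p (ξ p)
  connected : IsConnected S ∨ IsConnected (hypersurfaceInterior n (closure S))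

/-- `κ` is the surface gravity of `ξ` on `S`: `grad (g(ξ, ξ)) = -2 κ ξ` on `S`, that is,
`d(g(ξ, ξ)) (v) = -2 κ g(ξ, v)` for every tangent vector `v` of `M` at a point of `S`. -/
def IsSurfaceGravity (g : LorentzianMetric n M) (ξ : SmoothVF n M) (S : Set M) (κ : M → ℝ) :
    Prop :=
  ∀ p ∈ S, ∀ v : TangentSpace (𝓡 (n + 1)) p,
    mvfderiv (𝓡 (n + 1)) (g.pairing ξ ξ) p v = -2 * κ p * g.inner p (ξ p) v

/-- `H` is a multiple Killing horizon. -/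
def IsMultipleKillingHorizon (g : LorentzianMetric n M) (H : Set M) : Prop :=
  g.IsNullHypersurface H ∧
    ∃ (m : ℕ) (ξ : Fin m → SmoothVF n M) (S : Fin m → Set M), 2 ≤ m ∧
      LinearIndependent ℝ ξ ∧
      ∀ i, g.IsKillingHorizon (ξ i) (S i) ∧ closure (S i) = closure H

/-- The set `𝓐_H`: the zero vector field, and all Killing vectors that admit a Killing horizon
with the same closure as `H`. -/
def horizonKillingSet (g : LorentzianMetric n M) (H : Set M) : Set (SmoothVF n M) :=
  {ξ | ξ = 0 ∨ ∃ S : Set M, g.IsKillingHorizon ξ S ∧ closure S = closure H}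

/-- The set `𝓐_H^deg`: the zero vector field, and all Killing vectors that admit a degenerate
Killing horizon (one with vanishing surface gravity) with the same closure as `H`. -/
def degenerateKillingSet (g : LorentzianMetric n M) (H : Set M) : Set (SmoothVF n M) :=
  {ξ | ξ = 0 ∨ ∃ S : Set M, g.IsKillingHorizon ξ S ∧ closure S = closure H ∧
    g.IsSurfaceGravity ξ S 0}

end LorentzianMetric

/-!
The proof rests on one formula for the Lie bracket. Let `I` be the interior of the closure of `H`
and let `B` (`LorentzianMetric.normalKilling`) be the vector space of Killing fields that are
tangent and normal to `I`.

By density of a Killing horizon `S` in `I`, and since orthogonal null vectors are proportional,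
every element of `𝓐_H` lies in `B`. Conversely, the zeros of a nonzero `ξ ∈ B` are nowhere dense
in `I`: at a point near which `ξ` vanishes on `I`, its derivative is skew and vanishes on a
hyperplane, hence is zero, and a Killing field on a connected manifold is zero as soon as its
first jet vanishes at one point (`IsKilling.eq_zero_of_jet`). So `I \ {ξ = 0}` is a Killing
horizon of `ξ` with the closure of `H`, and `𝓐_H = B` (`horizonKillingSet_eq`). Since first jets
determine Killing fields, `B` has finite dimension.

Let `ζ ∈ B` be nonzero at `q ∈ I`. For `ξ ∈ B` the one-form `ξ♭` is conormal to `I`, so `dξ♭`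
vanishes on the tangent space of `I`, and `dξ♭ (ζ, ·) = 2 κ_q(ξ) ζ♭` at `q` for a number `κ_q(ξ)`
which depends linearly on `ξ` and is the surface gravity at `q` when `ξ = ζ`. The formula is

  `[ξ, η] = κ_q(η) ξ - κ_q(ξ) η` on all of `M`, for `ξ, η ∈ B`   (`lie_eq_of_isGravityAt`).

As `ξ` and `η` are proportional at `q`, one may replace one of them by a combination `ψ` of both
that vanishes at `q`. Then both sides are Killing fields, and by unique continuation it is enough
to compare their first jets at `q`; this is a computation with `𝓛_ψ dξ♭ = d[ψ, ξ]♭`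
(`CoordKilling.jet_lieBracket`).

Since `dim B ≥ 2`, every `ζ` has a linearly independent partner `η`, and comparing the
coefficients of `[ζ, η]` computed at two points shows that `κ_q(ζ)` does not depend on `q`. All
assertions of the theorem then follow by linear algebra from the bracket formula and the linear
functional `κ`.

Calculations take place in charts: a Killing field becomes a map `X : E → E` with vanishing
`CoordKilling.lieForm`, and `dX♭` becomes `CoordKilling.curlForm`, so that no connection is
needed.
-/

/-! ### Killing fields in coordinates -/

namespace CoordKilling

open Filter Topology

set_option maxSynthPendingDepth 3

variable {E : Type*} [NormedAddCommGroup E] [NormedSpace ℝ E]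

/-- The coordinate expression of the Lie derivative `(𝓛_X G)(v, w)` at `x` of a field of bilinear
forms `G` along the vector field `X`. -/
noncomputable def lieForm (G : E → E →L[ℝ] E →L[ℝ] ℝ) (X : E → E) (x v w : E) : ℝ :=
  fderiv ℝ G x (X x) v w + G x (fderiv ℝ X x v) w + G x v (fderiv ℝ X x w)

/-- The coordinate expression of `dα (v, w)` at `x` for the one-form `α = G(X, ·)`. -/
noncomputable def curlForm (G : E → E →L[ℝ] E →L[ℝ] ℝ) (X : E → E) (x v w : E) : ℝ :=
  fderiv ℝ G x v (X x) w + G x (fderiv ℝ X x v) w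
    - fderiv ℝ G x w (X x) v - G x (fderiv ℝ X x w) v

variable {G : E → E →L[ℝ] E →L[ℝ] ℝ} {X Y : E → E} {x : E}

theorem fderiv_apply_apply {A B : E → E} (hG : DifferentiableAt ℝ G x)
    (hA : DifferentiableAt ℝ A x) (hB : DifferentiableAt ℝ B x) (u : E) :
    fderiv ℝ (fun y ↦ G y (A y) (B y)) x u =
      fderiv ℝ G x u (A x) (B x) + G x (fderiv ℝ A x u) (B x) + G x (A x) (fderiv ℝ B x u) := by
  have h := (hG.hasFDerivAt.clm_apply hA.hasFDerivAt).clm_apply hB.hasFDerivAt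
  rw [h.fderiv]
  simp
  ring

theorem differentiableAt_fderiv {F : Type*} [NormedAddCommGroup F] [NormedSpace ℝ F] {f : E → F}
    (hf : ContDiffAt ℝ 2 f x) : DifferentiableAt ℝ (fderiv ℝ f) x :=
  (hf.fderiv_right (m := 1) (by norm_num)).differentiableAt (by norm_num)

theorem fderiv_fderiv_comm {F : Type*} [NormedAddCommGroup F] [NormedSpace ℝ F] {f : E → F}
    (hf : ContDiffAt ℝ 2 f x) (u v : E) :
    fderiv ℝ (fderiv ℝ f) x u v = fderiv ℝ (fderiv ℝ f) x v u :=
  (hf.isSymmSndFDerivAt (by simp)).eq u v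

theorem fderiv_lieForm (hG : ContDiffAt ℝ 2 G x) (hX : ContDiffAt ℝ 2 X x) (u v w : E) :
    fderiv ℝ (fun y ↦ lieForm G X y v w) x u =
      fderiv ℝ (fderiv ℝ G) x u (X x) v w + fderiv ℝ G x (fderiv ℝ X x u) v w
      + fderiv ℝ G x u (fderiv ℝ X x v) w + G x (fderiv ℝ (fderiv ℝ X) x u v) w
      + fderiv ℝ G x u v (fderiv ℝ X x w) + G x v (fderiv ℝ (fderiv ℝ X) x u w) := by
  have h1 : HasFDerivAt G _ x := (hG.differentiableAt (by norm_num)).hasFDerivAt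
  have h2 : HasFDerivAt X _ x := (hX.differentiableAt (by norm_num)).hasFDerivAt
  have h3 := (differentiableAt_fderiv hG).hasFDerivAt
  have h4 := (differentiableAt_fderiv hX).hasFDerivAt
  have hv := hasFDerivAt_const (𝕜 := ℝ) v x
  have hw := hasFDerivAt_const (𝕜 := ℝ) w x
  have h := ((((h3.clm_apply h2).clm_apply hv).clm_apply hw).add
    ((h1.clm_apply (h4.clm_apply hv)).clm_apply hw)).add
    ((h1.clm_apply hv).clm_apply (h4.clm_apply hw))
  have h' : HasFDerivAt (fun y ↦ lieForm G X y v w) _ x := h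
  rw [h'.fderiv]
  simp
  ring

/-- The second derivative of a Killing field is a linear function of its first jet. -/
theorem two_mul_apply_fderiv_fderiv (hG : ContDiffAt ℝ 2 G x) (hX : ContDiffAt ℝ 2 X x)
    (hsymm : ∀ v w, G x v w = G x w v)
    (hK : ∀ᶠ y in 𝓝 x, ∀ v w, lieForm G X y v w = 0) (u v w : E) :
    2 * G x (fderiv ℝ (fderiv ℝ X) x u v) w =
      -(fderiv ℝ (fderiv ℝ G) x u (X x) v w + fderiv ℝ G x (fderiv ℝ X x u) v w
        + fderiv ℝ G x u (fderiv ℝ X x v) w + fderiv ℝ G x u v (fderiv ℝ X x w))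
      -(fderiv ℝ (fderiv ℝ G) x v (X x) u w + fderiv ℝ G x (fderiv ℝ X x v) u w
        + fderiv ℝ G x v (fderiv ℝ X x u) w + fderiv ℝ G x v u (fderiv ℝ X x w))
      +(fderiv ℝ (fderiv ℝ G) x w (X x) u v + fderiv ℝ G x (fderiv ℝ X x w) u v
        + fderiv ℝ G x w (fderiv ℝ X x u) v + fderiv ℝ G x w u (fderiv ℝ X x v)) := by
  have key : ∀ a b c, fderiv ℝ (fun y ↦ lieForm G X y b c) x a = 0 := fun a b c ↦ by
    have : (fun y ↦ lieForm G X y b c) =ᶠ[𝓝 x] fun _ ↦ 0 := hK.mono fun y hy ↦ hy b c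
    rw [this.fderiv_eq]; simp
  have k1 := key u v w
  have k2 := key v u w
  have k3 := key w u v
  rw [fderiv_lieForm hG hX] at k1 k2 k3
  rw [fderiv_fderiv_comm hX v u] at k2
  rw [fderiv_fderiv_comm hX w u, fderiv_fderiv_comm hX w v] at k3
  rw [hsymm v] at k1
  rw [hsymm u] at k2
  rw [hsymm u] at k3
  linear_combination k1 + k2 - k3

/-- Brackets of Killing fields are Killing fields, in coordinates. -/
theorem lieForm_lieBracket (hG : ContDiffAt ℝ 2 G x) (hX : ContDiffAt ℝ 2 X x)
    (hY : ContDiffAt ℝ 2 Y x)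
    (hKX : ∀ᶠ y in 𝓝 x, ∀ v w, lieForm G X y v w = 0)
    (hKY : ∀ᶠ y in 𝓝 x, ∀ v w, lieForm G Y y v w = 0) (v w : E) :
    lieForm G (VectorField.lieBracket ℝ X Y) x v w = 0 := by
  have key : ∀ Z : E → E, (∀ᶠ y in 𝓝 x, ∀ v w, lieForm G Z y v w = 0) → ∀ a b c,
      fderiv ℝ (fun y ↦ lieForm G Z y b c) x a = 0 := fun Z hK a b c ↦ by
    have : (fun y ↦ lieForm G Z y b c) =ᶠ[𝓝 x] fun _ ↦ 0 := hK.mono fun y hy ↦ hy b c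
    rw [this.fderiv_eq]; simp
  have k1 := key X hKX (Y x) v w
  have k2 := key Y hKY (X x) v w
  rw [fderiv_lieForm hG hX] at k1
  rw [fderiv_lieForm hG hY] at k2
  have e1 := hKX.self_of_nhds (fderiv ℝ Y x v) w
  have e2 := hKX.self_of_nhds v (fderiv ℝ Y x w)
  have e3 := hKY.self_of_nhds (fderiv ℝ X x v) w
  have e4 := hKY.self_of_nhds v (fderiv ℝ X x w)
  have hD : ∀ u, fderiv ℝ (VectorField.lieBracket ℝ X Y) x u =
      fderiv ℝ (fderiv ℝ Y) x u (X x) + fderiv ℝ Y x (fderiv ℝ X x u)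
      - fderiv ℝ (fderiv ℝ X) x u (Y x) - fderiv ℝ X x (fderiv ℝ Y x u) := fun u ↦ by
    have h1 := (hX.differentiableAt (by norm_num)).hasFDerivAt
    have h2 := (hY.differentiableAt (by norm_num)).hasFDerivAt
    have h : HasFDerivAt (VectorField.lieBracket ℝ X Y) _ x :=
      ((differentiableAt_fderiv hY).hasFDerivAt.clm_apply h1).sub
        ((differentiableAt_fderiv hX).hasFDerivAt.clm_apply h2)
    rw [h.fderiv]
    simp
    abel
  simp only [lieForm] at e1 e2 e3 e4 ⊢
  rw [hD, hD, VectorField.lieBracket]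
  rw [fderiv_fderiv_comm hX (Y x) v, fderiv_fderiv_comm hX (Y x) w,
    fderiv_fderiv_comm hG (Y x) (X x)] at k1
  rw [fderiv_fderiv_comm hY (X x) v, fderiv_fderiv_comm hY (X x) w] at k2
  simp only [map_add, map_sub, add_apply, sub_apply]
  linear_combination k2 - k1 - e1 - e2 + e3 + e4

theorem curlForm_swap (v w : E) : curlForm G X x v w = -curlForm G X x w v := by
  simp only [curlForm]; ring

/-- Where a Killing field `X` vanishes, `dX♭ (v, w) = 2 G(DX v, w)`. -/
theorem curlForm_of_eq_zero (hsymm : ∀ v w, G x v w = G x w v) (hX : X x = 0)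
    (hK : ∀ v w, lieForm G X x v w = 0) (v w : E) :
    curlForm G X x v w = 2 * G x (fderiv ℝ X x v) w := by
  have := hK v w
  simp only [lieForm, curlForm, hX] at this ⊢
  simp at this ⊢
  rw [hsymm v] at this
  linarith

/-- Cartan's formula for `i_X dY♭`, where `X` is a Killing field. -/
theorem curlForm_apply_killing (hG : DifferentiableAt ℝ G x) (hX : DifferentiableAt ℝ X x)
    (hY : DifferentiableAt ℝ Y x) (hsymm : ∀ᶠ y in 𝓝 x, ∀ v w, G y v w = G y w v)
    (hK : ∀ v w, lieForm G X x v w = 0) (v : E) :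
    curlForm G Y x (X x) v =
      G x (VectorField.lieBracket ℝ X Y x) v - fderiv ℝ (fun y ↦ G y (X y) (Y y)) x v := by
  have hs : ∀ u v w, fderiv ℝ G x u v w = fderiv ℝ G x u w v := fun u v w ↦ by
    have h1 : ∀ a b : E, fderiv ℝ G x u a b = fderiv ℝ (fun y ↦ G y a b) x u := fun a b ↦ by
      rw [fderiv_apply_apply hG (differentiableAt_const a) (differentiableAt_const b)]; simp
    rw [h1, h1]
    have : (fun y ↦ G y v w) =ᶠ[𝓝 x] fun y ↦ G y w v := hsymm.mono fun y hy ↦ hy v w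
    rw [this.fderiv_eq]
  have hs0 := hsymm.self_of_nhds
  rw [fderiv_apply_apply hG hX hY]
  have k := hK (Y x) v
  simp only [lieForm, curlForm, VectorField.lieBracket, map_sub,
    sub_apply] at k ⊢
  rw [hs v (X x), hs0 (X x), hs0 (fderiv ℝ X x v)]
  linear_combination k

/-- At a zero of a Killing field `P`, with derivative `Ψ`, the identity `𝓛_P dX♭ = d[P, X]♭`
reads `d[P, X]♭ (u, v) = dX♭ (Ψ u, v) + dX♭ (u, Ψ v)`. -/
theorem curlForm_lieBracket {P : E → E} (hG : ContDiffAt ℝ 2 G x) (hX : ContDiffAt ℝ 2 X x)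
    (hP : ContDiffAt ℝ 2 P x) (hK : ∀ᶠ y in 𝓝 x, ∀ v w, lieForm G P y v w = 0)
    (hP0 : P x = 0) (u v : E) :
    curlForm G (VectorField.lieBracket ℝ P X) x u v =
      curlForm G X x (fderiv ℝ P x u) v + curlForm G X x u (fderiv ℝ P x v) := by
  have hD : ∀ u, fderiv ℝ (VectorField.lieBracket ℝ P X) x u =
      fderiv ℝ (fderiv ℝ X) x u (P x) + fderiv ℝ X x (fderiv ℝ P x u)
      - fderiv ℝ (fderiv ℝ P) x u (X x) - fderiv ℝ P x (fderiv ℝ X x u) := fun u ↦ by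
    have h1 := (hP.differentiableAt (by norm_num)).hasFDerivAt
    have h2 := (hX.differentiableAt (by norm_num)).hasFDerivAt
    have h : HasFDerivAt (VectorField.lieBracket ℝ P X) _ x :=
      ((differentiableAt_fderiv hX).hasFDerivAt.clm_apply h1).sub
        ((differentiableAt_fderiv hP).hasFDerivAt.clm_apply h2)
    rw [h.fderiv]
    simp
    abel
  have key : ∀ a b c, fderiv ℝ (fun y ↦ lieForm G P y b c) x a = 0 := fun a b c ↦ by
    have : (fun y ↦ lieForm G P y b c) =ᶠ[𝓝 x] fun _ ↦ 0 := hK.mono fun y hy ↦ hy b c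
    rw [this.fderiv_eq]; simp
  have k1 := key u (X x) v
  have k2 := key v (X x) u
  rw [fderiv_lieForm hG hP] at k1 k2
  have e1 := hK.self_of_nhds (fderiv ℝ X x u) v
  have e2 := hK.self_of_nhds (fderiv ℝ X x v) u
  simp only [lieForm, curlForm] at e1 e2 ⊢
  rw [hD, hD, VectorField.lieBracket]
  rw [fderiv_fderiv_comm hP v u] at k2
  simp only [map_add, map_sub, add_apply, sub_apply, hP0,
    map_zero, zero_apply] at k1 k2 e1 e2 ⊢
  linear_combination - k1 + k2 - e1 + e2

/-! ### Killing fields along a level set -/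

theorem curlForm_add (hX : DifferentiableAt ℝ X x) (hY : DifferentiableAt ℝ Y x) (v w : E) :
    curlForm G (X + Y) x v w = curlForm G X x v w + curlForm G Y x v w := by
  simp only [curlForm, fderiv_add hX hY, Pi.add_apply, map_add, add_apply]
  ring

theorem curlForm_const_smul (hX : DifferentiableAt ℝ X x) (c : ℝ) (v w : E) :
    curlForm G (c • X) x v w = c * curlForm G X x v w := by
  simp only [curlForm, fderiv_const_smul hX, Pi.smul_apply, map_smul, smul_apply, smul_eq_mul]
  ring

/-- A functional vanishing on the kernel of another one is a multiple of it. -/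
theorem exists_eq_mul_of_ker_le {F : Type*} [AddCommGroup F] [Module ℝ F] {ℓ β : F →ₗ[ℝ] ℝ}
    (h : ∀ v, ℓ v = 0 → β v = 0) : ∃ c : ℝ, ∀ v, β v = c * ℓ v := by
  by_cases hℓ : ∃ e, ℓ e ≠ 0
  · obtain ⟨e, he⟩ := hℓ
    refine ⟨β e / ℓ e, fun v ↦ ?_⟩
    have := h (v - (ℓ v / ℓ e) • e) (by simp [he])
    simp only [map_sub, map_smul, smul_eq_mul] at this
    field_simp at this ⊢
    linarith
  · push Not at hℓ
    exact ⟨0, fun v ↦ by simpa using h v (hℓ v)⟩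

/-- An alternating form whose radical contains a hyperplane `ker ℓ` is zero: its rank is at most
one, and even. -/
theorem alternating_eq_zero {F : Type*} [AddCommGroup F] [Module ℝ F] {ℓ : F →ₗ[ℝ] ℝ}
    (hℓ : ℓ ≠ 0) {β : F → F → ℝ} (hadd : ∀ u v w, β (u + v) w = β u w + β v w)
    (hsmul : ∀ (c : ℝ) u w, β (c • u) w = c * β u w) (hswap : ∀ u v, β u v = -β v u)
    (h : ∀ u w, ℓ u = 0 → β u w = 0) (u w : F) : β u w = 0 := by
  obtain ⟨e, he⟩ : ∃ e, ℓ e ≠ 0 := by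
    by_contra! h'
    exact hℓ (LinearMap.ext h')
  have red : ∀ u w, β u w = ℓ u / ℓ e * β e w := fun u w ↦ by
    have h0 : ℓ (u - (ℓ u / ℓ e) • e) = 0 := by simp [he]
    conv_lhs => rw [← sub_add_cancel u ((ℓ u / ℓ e) • e), hadd, h _ _ h0, hsmul, zero_add]
  have hee : β e e = 0 := by have := hswap e e; linarith
  rw [red u w, hswap e w, red w e, hee]; simp

/-- A function vanishing on a regular level set `{f = 0}` has a differential vanishing on the
tangent space of the level set. -/
theorem fderiv_eq_zero_of_eq_zero_on_level [CompleteSpace E] {f h : E → ℝ}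
    (hf : ContDiffAt ℝ 1 f x) (hh : ContDiffAt ℝ 1 h x) (hfx : f x = 0) (hdf : fderiv ℝ f x ≠ 0)
    (hvan : ∀ᶠ y in 𝓝 x, f y = 0 → h y = 0) {u : E} (hu : fderiv ℝ f x u = 0) :
    fderiv ℝ h x u = 0 := by
  have hext : IsLocalExtrOn h {y | f y = f x} x := by
    left
    have hx0 : h x = 0 := hvan.self_of_nhds hfx
    filter_upwards [hvan.filter_mono nhdsWithin_le_nhds, self_mem_nhdsWithin] with y hy hy'
    rw [hx0, hy (by rw [← hfx]; exact hy')]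
  obtain ⟨a, b, hab, hsum⟩ := hext.exists_multipliers_of_hasStrictFDerivAt_1d
    (hf.hasStrictFDerivAt (by norm_num)) (hh.hasStrictFDerivAt (by norm_num))
  have hb : b ≠ 0 := by
    rintro rfl
    rw [zero_smul, add_zero, smul_eq_zero] at hsum
    rcases hsum with rfl | h
    · exact hab rfl
    · exact hdf h
  have := congrArg (fun L ↦ L u) hsum
  simpa [hu, hb] using this

/-- If the one-form `G(X, ·)` is conormal to the level set `{f = 0}`, its exterior derivative
vanishes on pairs of tangent vectors of the level set. -/
theorem curlForm_eq_zero_of_conormal [CompleteSpace E] {f : E → ℝ} (hG : ContDiffAt ℝ 2 G x)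
    (hX : ContDiffAt ℝ 2 X x) (hf : ContDiffAt ℝ 2 f x) (hfx : f x = 0) (hdf : fderiv ℝ f x ≠ 0)
    (hcon : ∀ᶠ y in 𝓝 x, f y = 0 → ∀ v, fderiv ℝ f y v = 0 → G y (X y) v = 0)
    {u v : E} (hu : fderiv ℝ f x u = 0) (hv : fderiv ℝ f x v = 0) : curlForm G X x u v = 0 := by
  obtain ⟨e, he⟩ : ∃ e, fderiv ℝ f x e ≠ 0 := by
    by_contra! h'
    exact hdf (ContinuousLinearMap.ext h')
  have hf' : ContDiffAt ℝ 1 (fderiv ℝ f) x := hf.fderiv_right (by norm_num)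
  -- On the level set, `G(X, w) df(e) = G(X, e) df(w)` for every vector `w`.
  have key : ∀ a w, fderiv ℝ f x a = 0 → fderiv ℝ f x w = 0 →
      fderiv ℝ f x e * (fderiv ℝ G x a (X x) w + G x (fderiv ℝ X x a) w) =
        G x (X x) e * fderiv ℝ (fderiv ℝ f) x a w := by
    intro a w ha hw
    have hGX : ∀ w, ContDiffAt ℝ 1 (fun y ↦ G y (X y) w) x := fun w ↦
      ((hG.of_le (by norm_num)).clm_apply (hX.of_le (by norm_num))).clm_apply contDiffAt_const
    have hfw : ∀ w, ContDiffAt ℝ 1 (fun y ↦ fderiv ℝ f y w) x := fun w ↦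
      hf'.clm_apply contDiffAt_const
    have hder := fderiv_eq_zero_of_eq_zero_on_level (u := a)
      (h := fun y ↦ G y (X y) w * fderiv ℝ f y e - G y (X y) e * fderiv ℝ f y w)
      (hf.of_le (by norm_num)) (((hGX w).mul (hfw e)).sub ((hGX e).mul (hfw w))) hfx hdf ?_ ha
    · have d1 : ∀ w, DifferentiableAt ℝ (fun y ↦ G y (X y) w) x := fun w ↦
        (hGX w).differentiableAt (by norm_num)
      have d2 : ∀ w, DifferentiableAt ℝ (fun y ↦ fderiv ℝ f y w) x := fun w ↦
        (hfw w).differentiableAt (by norm_num)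
      have hder' := (((d1 w).hasFDerivAt.mul (d2 e).hasFDerivAt).sub
        ((d1 e).hasFDerivAt.mul (d2 w).hasFDerivAt)).fderiv
      replace hder := (congrArg (fun L ↦ L a) hder').symm.trans hder
      have e1 : fderiv ℝ (fun y ↦ G y (X y) w) x a =
          fderiv ℝ G x a (X x) w + G x (fderiv ℝ X x a) w := by
        rw [fderiv_apply_apply (hG.differentiableAt (by norm_num))
          (hX.differentiableAt (by norm_num)) (differentiableAt_const w)]
        simp
      have e2 : fderiv ℝ (fun y ↦ fderiv ℝ f y w) x a = fderiv ℝ (fderiv ℝ f) x a w := by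
        rw [fderiv_clm_apply (hf'.differentiableAt (by norm_num)) (differentiableAt_const w)]
        simp
      have hXw : G x (X x) w = 0 := hcon.self_of_nhds hfx w hw
      simp only [sub_apply, add_apply, smul_apply, smul_eq_mul, e1, e2, hw, hXw] at hder
      linear_combination hder
    · filter_upwards [hcon] with y hy hfy
      have := exists_eq_mul_of_ker_le (ℓ := (fderiv ℝ f y).toLinearMap)
        (β := (G y (X y)).toLinearMap) (hy hfy)
      obtain ⟨c, hc⟩ := this
      simp only [ContinuousLinearMap.coe_coe] at hc
      rw [hc, hc]; ring
  have k1 := key u v hu hv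
  have k2 := key v u hv hu
  rw [fderiv_fderiv_comm hf v u] at k2
  have : fderiv ℝ f x e * curlForm G X x u v = 0 := by
    simp only [curlForm]; linear_combination k1 - k2
  exact (mul_eq_zero.1 this).resolve_left he

/-- The first jet of a Killing field that vanishes on a hypersurface `{f = 0}` is zero: at a zero,
the derivative of a Killing field is skew, and here it vanishes on a hyperplane. -/
theorem fderiv_eq_zero_of_killing_of_level [CompleteSpace E] {f : E → ℝ}
    (hX : ContDiffAt ℝ 1 X x) (hsymm : ∀ v w, G x v w = G x w v)
    (hnd : ∀ v, (∀ w, G x v w = 0) → v = 0) (hf : ContDiffAt ℝ 1 f x) (hfx : f x = 0)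
    (hdf : fderiv ℝ f x ≠ 0) (hK : ∀ v w, lieForm G X x v w = 0)
    (hvan : ∀ᶠ y in 𝓝 x, f y = 0 → X y = 0) : fderiv ℝ X x = 0 := by
  have hX0 : X x = 0 := hvan.self_of_nhds hfx
  have hd : ∀ u w, fderiv ℝ f x u = 0 → G x (fderiv ℝ X x u) w = 0 := fun u w hu ↦ by
    have hL : ContDiffAt ℝ 1 (fun y ↦ G x (X y) w) x :=
      (contDiffAt_const.clm_apply hX).clm_apply contDiffAt_const
    have := fderiv_eq_zero_of_eq_zero_on_level (h := fun y ↦ G x (X y) w) hf hL hfx hdf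
      (hvan.mono fun y hy hfy ↦ by simp [hy hfy]) hu
    rw [fderiv_apply_apply (G := fun _ ↦ G x) (differentiableAt_const _)
      (hX.differentiableAt (by norm_num)) (differentiableAt_const w)] at this
    simpa using this
  ext u
  refine hnd _ fun w ↦ ?_
  refine alternating_eq_zero (ℓ := (fderiv ℝ f x).toLinearMap)
    (β := fun u w ↦ G x (fderiv ℝ X x u) w) (fun h ↦ hdf ?_) (by simp) (by simp) ?_ hd u w
  · ext v; exact LinearMap.congr_fun h v
  · intro u v
    have := hK u v
    simp only [lieForm, hX0, map_zero, zero_apply] at this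
    rw [hsymm u] at this
    linarith

/-- Let `X` and `P` be Killing fields such that `P` vanishes at `x` and `X` is at `x` a multiple of
a null normal `k` of a hyperplane `ker ℓ`, on which `dX♭` and `dP♭` vanish. If
`dX♭ (k, ·) = 2 κX G(k, ·)` and `dP♭ (k, ·) = 2 κP G(k, ·)` at `x`, then the first jets of
`[P, X]` and of `κX P - κP X` at `x` agree.

The derivative `Ψ` of `P` at `x` maps `ker ℓ` into the line of `k`, because `dP♭ = 2 G(Ψ ·, ·)`
vanishes on `ker ℓ`. Therefore `d[P, X]♭ (u, ·) = dX♭ (Ψ u, ·) + dX♭ (u, Ψ ·)` can be computed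
for `u` in `ker ℓ`, and this determines `d[P, X]♭` as an alternating form. -/
theorem jet_lieBracket {P : E → E} {ℓ : E →L[ℝ] ℝ} {k : E} {s κX κP : ℝ}
    (hG : ContDiffAt ℝ 2 G x) (hX : ContDiffAt ℝ 3 X x) (hP : ContDiffAt ℝ 3 P x)
    (hsymm : ∀ᶠ y in 𝓝 x, ∀ v w, G y v w = G y w v)
    (hnd : ∀ v, (∀ w, G x v w = 0) → v = 0)
    (hKX : ∀ᶠ y in 𝓝 x, ∀ v w, lieForm G X y v w = 0)
    (hKP : ∀ᶠ y in 𝓝 x, ∀ v w, lieForm G P y v w = 0)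
    (hℓ : ℓ ≠ 0) (hk0 : k ≠ 0) (hk : ∀ v, ℓ v = 0 → G x k v = 0)
    (hX0 : X x = s • k) (hP0 : P x = 0)
    (hcX : ∀ u v, ℓ u = 0 → ℓ v = 0 → curlForm G X x u v = 0)
    (hcP : ∀ u v, ℓ u = 0 → ℓ v = 0 → curlForm G P x u v = 0)
    (hκX : ∀ v, curlForm G X x k v = 2 * κX * G x k v)
    (hκP : ∀ v, curlForm G P x k v = 2 * κP * G x k v) :
    VectorField.lieBracket ℝ P X x = κX • P x - κP • X x ∧
      fderiv ℝ (VectorField.lieBracket ℝ P X) x = κX • fderiv ℝ P x - κP • fderiv ℝ X x := by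
  have hs := hsymm.self_of_nhds
  have hX1 : DifferentiableAt ℝ X x := hX.differentiableAt (by norm_num)
  have hP1 : DifferentiableAt ℝ P x := hP.differentiableAt (by norm_num)
  have hX2 : ContDiffAt ℝ 2 X x := hX.of_le (by norm_num)
  have hP2 : ContDiffAt ℝ 2 P x := hP.of_le (by norm_num)
  set Ψ := fderiv ℝ P x with hΨ
  have hPcurl : ∀ v w, curlForm G P x v w = 2 * G x (Ψ v) w :=
    curlForm_of_eq_zero hs hP0 hKP.self_of_nhds
  have hskew : ∀ v w, G x (Ψ v) w = -G x v (Ψ w) := fun v w ↦ by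
    have := hKP.self_of_nhds v w
    simp only [lieForm, hP0, map_zero, zero_apply] at this
    linarith
  -- `ker ℓ` is the orthogonal complement of `k`.
  have hker : ∀ v, G x k v = 0 → ℓ v = 0 := by
    obtain ⟨c, hc⟩ := exists_eq_mul_of_ker_le (ℓ := ℓ.toLinearMap) (β := (G x k).toLinearMap) hk
    simp only [ContinuousLinearMap.coe_coe] at hc
    have hc0 : c ≠ 0 := by
      rintro rfl
      exact hk0 (hnd k fun w ↦ by simpa using hc w)
    intro v hv
    rw [hc] at hv
    exact (mul_eq_zero.1 hv).resolve_left hc0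
  have hmul : ∀ (L : E →L[ℝ] ℝ), (∀ v, ℓ v = 0 → L v = 0) → ∃ c : ℝ, ∀ v, L v = c * G x k v :=
    fun L hL ↦ exists_eq_mul_of_ker_le (ℓ := (G x k).toLinearMap) (β := L.toLinearMap)
      fun v hv ↦ hL v (hker v hv)
  have hΨk : ∀ u, ℓ u = 0 → ∃ μ : ℝ, Ψ u = μ • k := fun u hu ↦ by
    obtain ⟨μ, hμ⟩ := hmul (G x (Ψ u)) fun v hv ↦ by
      have := hcP u v hu hv
      rw [hPcurl] at this
      linarith
    refine ⟨μ, sub_eq_zero.1 (hnd _ fun w ↦ ?_)⟩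
    simp [hμ]
  have hΨκ : Ψ k = κP • k := by
    refine sub_eq_zero.1 (hnd _ fun w ↦ ?_)
    have := hκP w
    rw [hPcurl] at this
    simp only [map_sub, map_smul, sub_apply, smul_apply, smul_eq_mul]
    linarith
  have hW0 : VectorField.lieBracket ℝ P X x = κX • P x - κP • X x := by
    rw [VectorField.lieBracket, hP0, hX0, ← hΨ]
    simp [hΨκ, smul_smul, mul_comm]
  refine ⟨hW0, ?_⟩
  -- `Z` is a Killing field vanishing at `x`, so that `dZ♭` at `x` encodes its derivative.
  set W := VectorField.lieBracket ℝ P X with hW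
  have hWd : DifferentiableAt ℝ W x :=
    ((hX.fderiv_right (m := 2) (by norm_num)).differentiableAt (by norm_num)).clm_apply hP1 |>.sub
      (((hP.fderiv_right (m := 2) (by norm_num)).differentiableAt (by norm_num)).clm_apply hX1)
  set Z : E → E := W + ((-κX) • P + κP • X) with hZ
  have hZd : fderiv ℝ Z x = fderiv ℝ W x + ((-κX) • Ψ + κP • fderiv ℝ X x) := by
    rw [hZ, fderiv_add hWd ((hP1.const_smul _).add (hX1.const_smul _)),
      fderiv_add (hP1.const_smul _) (hX1.const_smul _), fderiv_const_smul hP1,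
      fderiv_const_smul hX1]
  have hZ0 : Z x = 0 := by
    simp [hZ, hW0]
  have hWK : ∀ v w, lieForm G W x v w = 0 := lieForm_lieBracket hG hP2 hX2 hKP hKX
  have hZK : ∀ v w, lieForm G Z x v w = 0 := fun v w ↦ by
    have h1 := hWK v w
    have h2 := hKP.self_of_nhds v w
    have h3 := hKX.self_of_nhds v w
    simp only [lieForm, hZd] at h1 h2 h3 ⊢
    simp only [hZ, Pi.add_apply, Pi.smul_apply, map_add, map_smul, add_apply, smul_apply,
      smul_eq_mul]
    linear_combination h1 - κX * h2 + κP * h3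
  have hZcurl : ∀ u v, ℓ u = 0 → curlForm G Z x u v = 0 := fun u v hu ↦ by
    obtain ⟨μ, hμ⟩ := hΨk u hu
    have h1 : curlForm G W x u v = κX * curlForm G P x u v - κP * curlForm G X x u v := by
      obtain ⟨ν, hν⟩ : ∃ ν : ℝ, ∀ v, curlForm G X x u v = ν * G x k v := by
        obtain ⟨ν, hν⟩ := hmul (fderiv ℝ G x u (X x) + G x (fderiv ℝ X x u)
          - ((fderiv ℝ G x).flip (X x)).flip u - (G x ∘L fderiv ℝ X x).flip u) fun v hv ↦ by
            simpa [curlForm] using hcX u v hu hv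
        exact ⟨ν, fun v ↦ by simpa [curlForm] using hν v⟩
      rw [curlForm_lieBracket hG hX2 hP2 hKP hP0, ← hΨ, hμ, hPcurl, hμ, hν, hν]
      have h2 : curlForm G X x (μ • k) v = μ * curlForm G X x k v := by
        simp only [curlForm, map_smul, smul_apply, smul_eq_mul]; ring
      have h3 : G x k (Ψ v) = -(κP * G x k v) := by
        rw [← neg_eq_iff_eq_neg, ← hskew, hΨκ]; simp
      rw [h2, hκX, h3]
      simp only [map_smul, smul_apply, smul_eq_mul]
      ring
    rw [hZ, curlForm_add hWd ((hP1.const_smul _).add (hX1.const_smul _)),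
      curlForm_add (hP1.const_smul _) (hX1.const_smul _), curlForm_const_smul hP1,
      curlForm_const_smul hX1, h1]
    ring
  have hZzero : ∀ u v, curlForm G Z x u v = 0 :=
    alternating_eq_zero (ℓ := ℓ.toLinearMap) (fun h ↦ hℓ (by ext v; exact LinearMap.congr_fun h v))
      (fun u v w ↦ by simp only [curlForm, map_add, add_apply]; ring)
      (fun c u w ↦ by simp only [curlForm, map_smul, smul_apply, smul_eq_mul]; ring)
      curlForm_swap hZcurl
  have hZ' : fderiv ℝ Z x = 0 := by
    ext u
    refine hnd _ fun w ↦ ?_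
    have := hZzero u w
    rw [curlForm_of_eq_zero hs hZ0 hZK] at this
    simpa using this
  rw [hZd] at hZ'
  rw [← sub_eq_zero, ← hZ']
  module

/-! ### Unique continuation of Killing fields -/

/-- Nondegeneracy of `G` is locally uniform. -/
theorem exists_pos_eventually_le_norm_apply [FiniteDimensional ℝ E] (hG : ContinuousAt G x)
    (hnd : ∀ v, (∀ w, G x v w = 0) → v = 0) :
    ∃ c > 0, ∀ᶠ y in 𝓝 x, ∀ v, c * ‖v‖ ≤ ‖G y v‖ := by
  have hker : LinearMap.ker (G x).toLinearMap = ⊥ := by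
    refine LinearMap.ker_eq_bot'.2 fun v hv ↦ hnd v fun w ↦ ?_
    have : G x v = 0 := hv
    simp [this]
  obtain ⟨K, hK, hanti⟩ := (G x).toLinearMap.exists_antilipschitzWith hker
  have hle : ∀ v, ‖v‖ ≤ K * ‖G x v‖ := fun v ↦ by
    simpa using hanti.le_mul_dist v 0
  have hK' : (0 : ℝ) < K := hK
  refine ⟨1 / (2 * K), by positivity, ?_⟩
  have hd : ∀ᶠ y in 𝓝 x, ‖G y - G x‖ < 1 / (2 * K) := by
    have := (tendsto_iff_norm_sub_tendsto_zero.1 hG.tendsto)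
    exact this.eventually_lt_const (by positivity)
  filter_upwards [hd] with y hy v
  have h1 : ‖G x v‖ ≤ ‖G y v‖ + ‖G y - G x‖ * ‖v‖ := by
    have : G x v = G y v - (G y - G x) v := by simp
    rw [this]
    exact (norm_sub_le _ _).trans (add_le_add le_rfl ((G y - G x).le_opNorm v))
  have h2 := mul_le_mul_of_nonneg_right hy.le (norm_nonneg v)
  have h3 : 1 / K * ‖v‖ ≤ ‖G x v‖ := by
    rw [div_mul_eq_mul_div, one_mul, div_le_iff₀ hK']; linarith [hle v]
  have h4 : 1 / K * ‖v‖ = 1 / (2 * K) * ‖v‖ + 1 / (2 * K) * ‖v‖ := by field_simp; norm_num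
  linarith

/-- The estimate behind unique continuation: the derivative of the first jet of a Killing field is
bounded by the first jet. -/
theorem norm_fderiv_fderiv_le {c K : ℝ} (hc : 0 < c)
    (hG : ContDiffAt ℝ 2 G x) (hX : ContDiffAt ℝ 2 X x)
    (hsymm : ∀ v w, G x v w = G x w v)
    (hK : ∀ᶠ y in 𝓝 x, ∀ v w, lieForm G X y v w = 0) (hnd : ∀ v, c * ‖v‖ ≤ ‖G x v‖)
    (h1 : ‖fderiv ℝ G x‖ ≤ K) (h2 : ‖fderiv ℝ (fderiv ℝ G) x‖ ≤ K) (u : E) :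
    ‖fderiv ℝ (fderiv ℝ X) x u‖ ≤ 6 * K / c * max ‖X x‖ ‖fderiv ℝ X x‖ * ‖u‖ := by
  have hK0 : 0 ≤ K := (norm_nonneg _).trans h1
  set m := max ‖X x‖ ‖fderiv ℝ X x‖ with hm
  have hm0 : 0 ≤ m := (norm_nonneg _).trans (le_max_left _ _)
  have b2 : ∀ a b d, |fderiv ℝ (fderiv ℝ G) x a (X x) b d| ≤ K * m * (‖a‖ * ‖b‖ * ‖d‖) :=
    fun a b d ↦ by
    calc |fderiv ℝ (fderiv ℝ G) x a (X x) b d|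
        ≤ ‖fderiv ℝ (fderiv ℝ G) x a (X x)‖ * ‖b‖ * ‖d‖ :=
          (fderiv ℝ (fderiv ℝ G) x a (X x)).le_opNorm₂ b d
      _ ≤ (‖fderiv ℝ (fderiv ℝ G) x‖ * ‖a‖ * ‖X x‖) * ‖b‖ * ‖d‖ := by
          gcongr; exact (fderiv ℝ (fderiv ℝ G) x).le_opNorm₂ a (X x)
      _ ≤ (K * ‖a‖ * m) * ‖b‖ * ‖d‖ := by gcongr; exact le_max_left _ _
      _ = _ := by ring
  have b1 : ∀ a b d, |fderiv ℝ G x a b d| ≤ K * (‖a‖ * ‖b‖ * ‖d‖) := fun a b d ↦ by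
    calc |fderiv ℝ G x a b d| ≤ ‖fderiv ℝ G x a‖ * ‖b‖ * ‖d‖ := (fderiv ℝ G x a).le_opNorm₂ b d
      _ ≤ (‖fderiv ℝ G x‖ * ‖a‖) * ‖b‖ * ‖d‖ := by
          gcongr; exact (fderiv ℝ G x).le_opNorm a
      _ ≤ (K * ‖a‖) * ‖b‖ * ‖d‖ := by gcongr
      _ = _ := by ring
  have b0 : ∀ a, ‖fderiv ℝ X x a‖ ≤ m * ‖a‖ := fun a ↦
    ((fderiv ℝ X x).le_opNorm a).trans (by gcongr; exact le_max_right _ _)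
  have c1 : ∀ a b d, |fderiv ℝ G x (fderiv ℝ X x a) b d| ≤ K * m * (‖a‖ * ‖b‖ * ‖d‖) :=
    fun a b d ↦ (b1 _ _ _).trans (by
      calc K * (‖fderiv ℝ X x a‖ * ‖b‖ * ‖d‖) ≤ K * ((m * ‖a‖) * ‖b‖ * ‖d‖) := by
            gcongr; exact b0 a
        _ = _ := by ring)
  have c2 : ∀ a b d, |fderiv ℝ G x a (fderiv ℝ X x b) d| ≤ K * m * (‖a‖ * ‖b‖ * ‖d‖) :=
    fun a b d ↦ (b1 _ _ _).trans (by
      calc K * (‖a‖ * ‖fderiv ℝ X x b‖ * ‖d‖) ≤ K * (‖a‖ * (m * ‖b‖) * ‖d‖) := by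
            gcongr; exact b0 b
        _ = _ := by ring)
  have c3 : ∀ a b d, |fderiv ℝ G x a b (fderiv ℝ X x d)| ≤ K * m * (‖a‖ * ‖b‖ * ‖d‖) :=
    fun a b d ↦ (b1 _ _ _).trans (by
      calc K * (‖a‖ * ‖b‖ * ‖fderiv ℝ X x d‖) ≤ K * (‖a‖ * ‖b‖ * (m * ‖d‖)) := by
            gcongr; exact b0 d
        _ = _ := by ring)
  refine ContinuousLinearMap.opNorm_le_bound _ (by positivity) fun v ↦ ?_
  have hGv : ‖G x (fderiv ℝ (fderiv ℝ X) x u v)‖ ≤ 6 * K * m * ‖u‖ * ‖v‖ := by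
    refine ContinuousLinearMap.opNorm_le_bound _ (by positivity) fun w ↦ ?_
    have key := two_mul_apply_fderiv_fderiv hG hX hsymm hK u v w
    have hr1 : ‖v‖ * ‖u‖ * ‖w‖ = ‖u‖ * ‖v‖ * ‖w‖ := by ring
    have hr2 : ‖w‖ * ‖u‖ * ‖v‖ = ‖u‖ * ‖v‖ * ‖w‖ := by ring
    have a1 := b2 u v w
    have a2 := c1 u v w
    have a3 := c2 u v w
    have a4 := c3 u v w
    have a5 := b2 v u w
    have a6 := c1 v u w
    have a7 := c2 v u w
    have a8 := c3 v u w
    have a9 := b2 w u v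
    have a10 := c1 w u v
    have a11 := c2 w u v
    have a12 := c3 w u v
    rw [hr1] at a5 a6 a7 a8
    rw [hr2] at a9 a10 a11 a12
    rw [Real.norm_eq_abs, abs_le]
    rw [abs_le] at a1 a2 a3 a4 a5 a6 a7 a8 a9 a10 a11 a12
    constructor <;> linarith
  have := (hnd _).trans hGv
  rw [← le_div_iff₀' hc] at this
  refine this.trans (le_of_eq ?_)
  field_simp

theorem exists_eventually_norm_fderiv_le {F : Type*} [NormedAddCommGroup F] [NormedSpace ℝ F]
    {f : E → F} (hf : ContDiffAt ℝ 3 f x) :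
    ∃ K, ∀ᶠ y in 𝓝 x, ‖fderiv ℝ f y‖ ≤ K ∧ ‖fderiv ℝ (fderiv ℝ f) y‖ ≤ K := by
  have h1 : ContDiffAt ℝ 2 (fderiv ℝ f) x := hf.fderiv_right (by norm_num)
  have h2 : ContDiffAt ℝ 1 (fderiv ℝ (fderiv ℝ f)) x := h1.fderiv_right (by norm_num)
  refine ⟨max ‖fderiv ℝ f x‖ ‖fderiv ℝ (fderiv ℝ f) x‖ + 1, ?_⟩
  filter_upwards
    [h1.continuousAt.norm.eventually_lt_const ((le_max_left _ _).trans_lt (lt_add_one _)),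
      h2.continuousAt.norm.eventually_lt_const ((le_max_right _ _).trans_lt (lt_add_one _))]
    with y hy1 hy2 using ⟨hy1.le, hy2.le⟩

/-- A Killing field whose first jet vanishes at a point vanishes near this point: along the
segments issued from the point, its first jet solves a homogeneous linear differential
equation. -/
theorem eventually_eq_zero_of_jet_eq_zero [FiniteDimensional ℝ E] {T : Set E} (hT : IsOpen T)
    (hxT : x ∈ T) (hG : ContDiffOn ℝ 3 G T) (hX : ContDiffOn ℝ 2 X T)
    (hsymm : ∀ y ∈ T, ∀ v w, G y v w = G y w v) (hK : ∀ y ∈ T, ∀ v w, lieForm G X y v w = 0)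
    (hnd : ∀ v, (∀ w, G x v w = 0) → v = 0) (h0 : X x = 0) (h1 : fderiv ℝ X x = 0) :
    ∀ᶠ y in 𝓝 x, X y = 0 := by
  have hGx : ContDiffAt ℝ 3 G x := hG.contDiffAt (hT.mem_nhds hxT)
  obtain ⟨c, hc, hcG⟩ := exists_pos_eventually_le_norm_apply hGx.continuousAt hnd
  obtain ⟨K, hKG⟩ := exists_eventually_norm_fderiv_le hGx
  have hK0 : 0 ≤ K := (norm_nonneg _).trans hKG.self_of_nhds.1
  obtain ⟨r, hr, hball⟩ := Metric.eventually_nhds_iff_ball.1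
    (((hT.eventually_mem hxT).and hcG).and hKG)
  filter_upwards [Metric.ball_mem_nhds x hr] with y hy
  set γ : ℝ → E := fun t ↦ x + t • (y - x) with hγ
  have hγball : ∀ t ∈ Icc (0 : ℝ) 1, γ t ∈ Metric.ball x r := fun t ht ↦ by
    have := (convex_ball x r).add_smul_sub_mem (Metric.mem_ball_self hr) hy ht
    exact this
  have hγd : ∀ t, HasDerivAt γ (y - x) t := fun t ↦ by
    simpa [hγ] using ((hasDerivAt_id t).smul_const (y - x)).const_add x
  have hXat : ∀ t ∈ Icc (0 : ℝ) 1, ContDiffAt ℝ 2 X (γ t) := fun t ht ↦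
    hX.contDiffAt (hT.mem_nhds (hball _ (hγball t ht)).1.1)
  have hder : ∀ t ∈ Icc (0 : ℝ) 1, HasDerivAt (fun t ↦ (X (γ t), fderiv ℝ X (γ t)))
      (fderiv ℝ X (γ t) (y - x), fderiv ℝ (fderiv ℝ X) (γ t) (y - x)) t := fun t ht ↦
    (((hXat t ht).differentiableAt (by norm_num)).hasFDerivAt.comp_hasDerivAt t (hγd t)).prodMk
      ((differentiableAt_fderiv (hXat t ht)).hasFDerivAt.comp_hasDerivAt t (hγd t))
  have hfin := eq_zero_of_abs_deriv_le_mul_abs_self_of_eq_zero_right (a := 0) (b := 1)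
    (f := fun t ↦ (X (γ t), fderiv ℝ X (γ t)))
    (f' := fun t ↦ (fderiv ℝ X (γ t) (y - x), fderiv ℝ (fderiv ℝ X) (γ t) (y - x)))
    (K := (1 + 6 * K / c) * ‖y - x‖)
    (fun t ht ↦ (hder t ht).continuousAt.continuousWithinAt)
    (fun t ht ↦ (hder t ⟨ht.1, ht.2.le⟩).hasDerivWithinAt)
    (by simp [hγ, h0, h1]) ?_ 1 (by simp)
  · have := congrArg Prod.fst hfin
    simpa [hγ] using this
  · intro t ht
    have ht' : t ∈ Icc (0 : ℝ) 1 := ⟨ht.1, ht.2.le⟩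
    obtain ⟨⟨hT1, hnd1⟩, hb1, hb2⟩ := hball _ (hγball t ht')
    have hev : ∀ᶠ z in 𝓝 (γ t), ∀ v w, lieForm G X z v w = 0 :=
      (hT.eventually_mem hT1).mono hK
    have key := norm_fderiv_fderiv_le hc
      ((hG.contDiffAt (hT.mem_nhds hT1)).of_le (by norm_num)) (hXat t ht')
      (hsymm _ hT1) hev hnd1 hb1 hb2 (y - x)
    rw [Prod.norm_mk, Prod.norm_mk]
    set m := max ‖X (γ t)‖ ‖fderiv ℝ X (γ t)‖ with hm
    have hm0 : 0 ≤ m := (norm_nonneg _).trans (le_max_left _ _)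
    refine max_le ?_ ?_
    · refine ((fderiv ℝ X (γ t)).le_opNorm _).trans ?_
      calc ‖fderiv ℝ X (γ t)‖ * ‖y - x‖ ≤ m * ‖y - x‖ := by gcongr; exact le_max_right _ _
        _ ≤ (1 + 6 * K / c) * (m * ‖y - x‖) := by
            refine le_mul_of_one_le_left (by positivity) ?_
            have : 0 ≤ 6 * K / c := by positivity
            linarith
        _ = _ := by ring
    · refine key.trans ?_
      calc 6 * K / c * m * ‖y - x‖ ≤ (1 + 6 * K / c) * m * ‖y - x‖ := by gcongr; linarith
        _ = _ := by ring

end CoordKilling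

/-! ### Vector fields and metrics in a chart -/

namespace SmoothVF

open Filter Topology VectorField

variable {n : ℕ} {M : Type*} [TopologicalSpace M]
  [ChartedSpace (EuclideanSpace ℝ (Fin (n + 1))) M] [IsManifold (𝓡 (n + 1)) ∞ M]

variable (n) in
/-- The differential of the inverse of the chart at `p`. -/
noncomputable def chartDeriv (p : M) (x : EuclideanSpace ℝ (Fin (n + 1))) :
    EuclideanSpace ℝ (Fin (n + 1)) →L[ℝ]
      TangentSpace (𝓡 (n + 1)) ((extChartAt (𝓡 (n + 1)) p).symm x) :=
  mfderiv (𝓡 (n + 1)) (𝓡 (n + 1)) (extChartAt (𝓡 (n + 1)) p).symm x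

/-- The coordinate expression of a vector field in the chart at `p`. -/
noncomputable def inChart (X : SmoothVF n M) (p : M) :
    EuclideanSpace ℝ (Fin (n + 1)) → EuclideanSpace ℝ (Fin (n + 1)) :=
  mpullback (𝓡 (n + 1)) (𝓡 (n + 1)) (extChartAt (𝓡 (n + 1)) p).symm X

variable {p : M} {x : EuclideanSpace ℝ (Fin (n + 1))}

theorem contMDiffAt_chart_symm (hx : x ∈ (extChartAt (𝓡 (n + 1)) p).target) :
    ContMDiffAt (𝓡 (n + 1)) (𝓡 (n + 1)) ∞ (extChartAt (𝓡 (n + 1)) p).symm x :=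
  (contMDiffOn_extChartAt_symm p).contMDiffAt ((isOpen_extChartAt_target p).mem_nhds hx)

theorem isInvertible_chartDeriv (hx : x ∈ (extChartAt (𝓡 (n + 1)) p).target) :
    (mfderiv (𝓡 (n + 1)) (𝓡 (n + 1)) (extChartAt (𝓡 (n + 1)) p).symm x).IsInvertible := by
  have := isInvertible_mfderivWithin_extChartAt_symm (I := 𝓡 (n + 1)) hx
  simpa [mfderivWithin_univ] using this

theorem chartDeriv_injective (hx : x ∈ (extChartAt (𝓡 (n + 1)) p).target) :
    Function.Injective (chartDeriv n p x) := by
  obtain ⟨e, he⟩ := isInvertible_chartDeriv hx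
  intro v w h
  have h1 : ∀ v, chartDeriv n p x v = e v := fun v ↦ by
    rw [chartDeriv, ← he]; rfl
  rw [h1, h1] at h
  exact e.injective h

theorem chartDeriv_surjective (hx : x ∈ (extChartAt (𝓡 (n + 1)) p).target) :
    Function.Surjective (chartDeriv n p x) := by
  obtain ⟨e, he⟩ := isInvertible_chartDeriv hx
  intro v
  have h1 : ∀ v, chartDeriv n p x v = e v := fun v ↦ by
    rw [chartDeriv, ← he]; rfl
  exact ⟨e.symm v, (h1 _).trans (e.apply_symm_apply v)⟩

theorem chartDeriv_inChart (X : SmoothVF n M) (hx : x ∈ (extChartAt (𝓡 (n + 1)) p).target) :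
    chartDeriv n p x (X.inChart p x) = X ((extChartAt (𝓡 (n + 1)) p).symm x) := by
  obtain ⟨e, he⟩ := isInvertible_chartDeriv hx
  rw [inChart, mpullback_apply, chartDeriv, ← he, ContinuousLinearMap.inverse_equiv]
  exact e.apply_symm_apply _

theorem contDiffOn_inChart (X : SmoothVF n M) (p : M) :
    ContDiffOn ℝ ∞ (X.inChart p) (extChartAt (𝓡 (n + 1)) p).target := by
  intro x hx
  refine ContDiffAt.contDiffWithinAt ?_
  refine contMDiffAt_vectorSpace_iff_contDiffAt.1 ?_
  exact ContMDiffAt.mpullback_vectorField_preimage (X.contMDiff _) (contMDiffAt_chart_symm hx)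
    (isInvertible_chartDeriv hx) (by simp)

theorem contDiffAt_inChart (X : SmoothVF n M) (hx : x ∈ (extChartAt (𝓡 (n + 1)) p).target) :
    ContDiffAt ℝ ∞ (X.inChart p) x :=
  (X.contDiffOn_inChart p).contDiffAt ((isOpen_extChartAt_target p).mem_nhds hx)

theorem inChart_add (X Y : SmoothVF n M) (p : M) :
    (X + Y).inChart p = X.inChart p + Y.inChart p := by
  rw [inChart, ContMDiffSection.coe_add, mpullback_add]; rfl

theorem inChart_smul (c : ℝ) (X : SmoothVF n M) (p : M) :
    (c • X).inChart p = c • X.inChart p := by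
  rw [inChart, ContMDiffSection.coe_smul, mpullback_const_smul]; rfl

theorem inChart_bracket (X Y : SmoothVF n M) (hx : x ∈ (extChartAt (𝓡 (n + 1)) p).target) :
    (⁅X, Y⁆ : SmoothVF n M).inChart p x = lieBracket ℝ (X.inChart p) (Y.inChart p) x := by
  have h2 : IsManifold (𝓡 (n + 1)) (minSmoothness ℝ 2) M := by
    rw [minSmoothness_of_isRCLikeNormedField]; infer_instance
  rw [inChart, coe_bracket, mpullback_mlieBracket (X.mdifferentiableAt) (Y.mdifferentiableAt)
    (contMDiffAt_chart_symm hx) (by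
      rw [minSmoothness_of_isRCLikeNormedField]; exact WithTop.coe_le_coe.2 le_top),
    ← mlieBracketWithin_univ, mlieBracketWithin_eq_lieBracketWithin]
  exact congrFun lieBracketWithin_univ x

theorem mvfderiv_chartDeriv {f : M → ℝ} (hx : x ∈ (extChartAt (𝓡 (n + 1)) p).target)
    (hf : MDifferentiableAt (𝓡 (n + 1)) 𝓘(ℝ, ℝ) f ((extChartAt (𝓡 (n + 1)) p).symm x))
    (v : EuclideanSpace ℝ (Fin (n + 1))) :
    mvfderiv (𝓡 (n + 1)) f ((extChartAt (𝓡 (n + 1)) p).symm x) (chartDeriv n p x v) =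
      fderiv ℝ (f ∘ (extChartAt (𝓡 (n + 1)) p).symm) x v := by
  have h := mvfderiv_comp_apply x hf
    ((contMDiffAt_chart_symm hx).mdifferentiableAt (by simp)) v
  refine h.symm.trans ?_
  rw [mvfderiv, mfderiv_eq_fderiv]
  rfl

/-- Every tangent vector is the value of a globally defined smooth vector field. -/
theorem exists_apply_eq [T2Space M] (p : M) (v : TangentSpace (𝓡 (n + 1)) p) :
    ∃ X : SmoothVF n M, X p = v := by
  obtain ⟨s, hs, hsm⟩ := FiberBundle.exists_contMDiffOn_extend (k := ∞) (𝓡 (n + 1))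
    (EuclideanSpace ℝ (Fin (n + 1))) v
  obtain ⟨u, hus, hu, hpu⟩ := mem_nhds_iff.1 hs
  obtain ⟨ψ, -, hψ⟩ := (SmoothBumpFunction.nhds_basis_tsupport (I := 𝓡 (n + 1)) p).mem_iff.1
    (hu.mem_nhds hpu)
  have := ContMDiffOn.smul_section_of_tsupport (ψ := ψ) (ψ.contMDiff.contMDiffOn) hu hψ
    (hsm.mono hus)
  exact ⟨⟨_, this⟩, by simp⟩

theorem exists_inChart_eq [T2Space M] (hx : x ∈ (extChartAt (𝓡 (n + 1)) p).target)
    (v : EuclideanSpace ℝ (Fin (n + 1))) : ∃ X : SmoothVF n M, X.inChart p x = v := by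
  obtain ⟨X, hX⟩ := exists_apply_eq ((extChartAt (𝓡 (n + 1)) p).symm x) (chartDeriv n p x v)
  exact ⟨X, chartDeriv_injective hx (by rw [chartDeriv_inChart _ hx, hX])⟩

theorem contMDiffAt_chartDeriv (hx : x ∈ (extChartAt (𝓡 (n + 1)) p).target)
    (v : EuclideanSpace ℝ (Fin (n + 1))) :
    ContMDiffAt (𝓡 (n + 1)) (𝓡 (n + 1)).tangent ∞ (fun y ↦ Bundle.TotalSpace.mk'
      (EuclideanSpace ℝ (Fin (n + 1))) (E := (TangentSpace (𝓡 (n + 1)) : M → Type _))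
      ((extChartAt (𝓡 (n + 1)) p).symm y) (chartDeriv n p y v)) x := by
  have ho := isOpen_extChartAt_target (I := 𝓡 (n + 1)) p
  have h1 := (contMDiffOn_extChartAt_symm (I := 𝓡 (n + 1)) (n := ∞) p).contMDiffOn_tangentMapWithin
    (m := ∞) (by simp) ho.uniqueMDiffOn
  have h2 : ContMDiffAt (𝓡 (n + 1)) (𝓡 (n + 1)).tangent ∞
      (fun y : EuclideanSpace ℝ (Fin (n + 1)) ↦ (⟨y, v⟩ : TangentBundle (𝓡 (n + 1))
        (EuclideanSpace ℝ (Fin (n + 1))))) x :=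
    contMDiffAt_vectorSpace_iff_contDiffAt.2 contDiffAt_const
  have h3 := (h1 ⟨x, v⟩ hx).comp x (h2.contMDiffWithinAt (s := (extChartAt (𝓡 (n + 1)) p).target))
    (fun y hy ↦ hy)
  refine (h3.contMDiffAt (ho.mem_nhds hx)).congr_of_eventuallyEq ?_
  filter_upwards [ho.mem_nhds hx] with y hy
  rw [chartDeriv, ← mfderivWithin_of_isOpen ho hy]
  rfl

end SmoothVF

namespace LorentzianMetric

open Filter Topology VectorField SmoothVF

variable {n : ℕ} {M : Type*} [TopologicalSpace M]
  [ChartedSpace (EuclideanSpace ℝ (Fin (n + 1))) M] [IsManifold (𝓡 (n + 1)) ∞ M]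

/-- The coordinate expression of the metric in the chart at `p`. -/
noncomputable def inChart (g : LorentzianMetric n M) (p : M) (x : EuclideanSpace ℝ (Fin (n + 1))) :
    EuclideanSpace ℝ (Fin (n + 1)) →L[ℝ] EuclideanSpace ℝ (Fin (n + 1)) →L[ℝ] ℝ :=
  ContinuousLinearMap.bilinearComp (E := EuclideanSpace ℝ (Fin (n + 1)))
    (F := EuclideanSpace ℝ (Fin (n + 1))) (g.inner ((extChartAt (𝓡 (n + 1)) p).symm x))
    (chartDeriv n p x) (chartDeriv n p x)

variable (g : LorentzianMetric n M) {p : M} {x : EuclideanSpace ℝ (Fin (n + 1))}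

theorem inChart_apply (v w : EuclideanSpace ℝ (Fin (n + 1))) :
    g.inChart p x v w =
      g.inner ((extChartAt (𝓡 (n + 1)) p).symm x) (chartDeriv n p x v) (chartDeriv n p x w) :=
  rfl

theorem contMDiffAt_inner_apply {N F : Type*} [NormedAddCommGroup F] [NormedSpace ℝ F]
    [TopologicalSpace N] [ChartedSpace F N] {y : N} {b : N → M}
    {v w : ∀ z, TangentSpace (𝓡 (n + 1)) (b z)}
    (hb : ContMDiffAt 𝓘(ℝ, F) (𝓡 (n + 1)) ∞ b y)
    (hv : ContMDiffAt 𝓘(ℝ, F) (𝓡 (n + 1)).tangent ∞ (fun z ↦ Bundle.TotalSpace.mk'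
      (EuclideanSpace ℝ (Fin (n + 1))) (E := (TangentSpace (𝓡 (n + 1)) : M → Type _))
      (b z) (v z)) y)
    (hw : ContMDiffAt 𝓘(ℝ, F) (𝓡 (n + 1)).tangent ∞ (fun z ↦ Bundle.TotalSpace.mk'
      (EuclideanSpace ℝ (Fin (n + 1))) (E := (TangentSpace (𝓡 (n + 1)) : M → Type _))
      (b z) (w z)) y) :
    ContMDiffAt 𝓘(ℝ, F) 𝓘(ℝ, ℝ) ∞ (fun z ↦ g.inner (b z) (v z) (w z)) y := by
  have : ContMDiffAt 𝓘(ℝ, F) ((𝓡 (n + 1)).prod 𝓘(ℝ)) ∞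
      (fun m ↦ Bundle.TotalSpace.mk' ℝ (E := Bundle.Trivial M ℝ) (b m)
        (g.inner (b m) (v m) (w m))) y := by
    apply ContMDiffAt.clm_bundle_apply₂ (F₁ := EuclideanSpace ℝ (Fin (n + 1)))
      (F₂ := EuclideanSpace ℝ (Fin (n + 1)))
    · exact ContMDiffAt.comp y g.contMDiff.contMDiffAt hb
    · exact hv
    · exact hw
  simp only [Bundle.contMDiffAt_totalSpace] at this
  exact this.2

theorem contMDiff_pairing (X Y : SmoothVF n M) :
    ContMDiff (𝓡 (n + 1)) 𝓘(ℝ, ℝ) ∞ (g.pairing X Y) := fun q ↦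
  g.contMDiffAt_inner_apply contMDiffAt_id (X.contMDiff q) (Y.contMDiff q)

theorem contDiffOn_inChart (p : M) :
    ContDiffOn ℝ ∞ (g.inChart p) (extChartAt (𝓡 (n + 1)) p).target := by
  rw [contDiffOn_clm_apply]
  intro v
  rw [contDiffOn_clm_apply]
  intro w x hx
  refine (ContMDiffAt.contDiffAt ?_).contDiffWithinAt
  exact g.contMDiffAt_inner_apply (contMDiffAt_chart_symm hx) (contMDiffAt_chartDeriv hx v)
    (contMDiffAt_chartDeriv hx w)

theorem contDiffAt_inChart (hx : x ∈ (extChartAt (𝓡 (n + 1)) p).target) :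
    ContDiffAt ℝ ∞ (g.inChart p) x :=
  (g.contDiffOn_inChart p).contDiffAt ((isOpen_extChartAt_target p).mem_nhds hx)

theorem inChart_symm (v w : EuclideanSpace ℝ (Fin (n + 1))) :
    g.inChart p x v w = g.inChart p x w v := g.symm _ _ _

theorem nondegenerate {q : M} {v : TangentSpace (𝓡 (n + 1)) q}
    (h : ∀ w, g.inner q v w = 0) : v = 0 := by
  obtain ⟨b, hb⟩ := g.signature q
  refine b.repr.injective (Finsupp.ext fun j ↦ ?_)
  have h1 := h (b j)
  conv_lhs at h1 => rw [← b.sum_repr v]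
  simp only [map_sum, map_smul, sum_apply, smul_apply, hb] at h1
  simp only [smul_eq_mul, mul_ite, mul_zero, Finset.sum_ite_eq', Finset.mem_univ, if_true] at h1
  split_ifs at h1 <;> simpa using h1

theorem inChart_nondegenerate (hx : x ∈ (extChartAt (𝓡 (n + 1)) p).target)
    {v : EuclideanSpace ℝ (Fin (n + 1))} (h : ∀ w, g.inChart p x v w = 0) : v = 0 := by
  refine chartDeriv_injective hx ?_
  rw [map_zero]
  refine g.nondegenerate fun w ↦ ?_
  obtain ⟨w, rfl⟩ := chartDeriv_surjective hx w
  exact h w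

theorem pairing_chart_symm (X Y : SmoothVF n M) (hx : x ∈ (extChartAt (𝓡 (n + 1)) p).target) :
    g.pairing X Y ((extChartAt (𝓡 (n + 1)) p).symm x) =
      g.inChart p x (X.inChart p x) (Y.inChart p x) := by
  rw [inChart_apply, chartDeriv_inChart _ hx, chartDeriv_inChart _ hx]; rfl

theorem mvfderiv_pairing (X Y : SmoothVF n M) (hx : x ∈ (extChartAt (𝓡 (n + 1)) p).target)
    (v : EuclideanSpace ℝ (Fin (n + 1))) :
    mvfderiv (𝓡 (n + 1)) (g.pairing X Y) ((extChartAt (𝓡 (n + 1)) p).symm x)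
      (chartDeriv n p x v) =
      fderiv ℝ (fun y ↦ g.inChart p y (X.inChart p y) (Y.inChart p y)) x v := by
  rw [mvfderiv_chartDeriv hx ((g.contMDiff_pairing X Y).mdifferentiableAt (by simp))]
  have : g.pairing X Y ∘ (extChartAt (𝓡 (n + 1)) p).symm =ᶠ[𝓝 x]
      fun y ↦ g.inChart p y (X.inChart p y) (Y.inChart p y) := by
    filter_upwards [(isOpen_extChartAt_target p).mem_nhds hx] with y hy
    exact g.pairing_chart_symm X Y hy
  rw [this.fderiv_eq]

/-- The Lie derivative of the metric along `ξ`, evaluated in a chart. -/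
theorem lie_pairing_eq (ξ X Y : SmoothVF n M) (hx : x ∈ (extChartAt (𝓡 (n + 1)) p).target) :
    mvfderiv (𝓡 (n + 1)) (g.pairing X Y) ((extChartAt (𝓡 (n + 1)) p).symm x)
        (ξ ((extChartAt (𝓡 (n + 1)) p).symm x))
      - g.pairing ⁅ξ, X⁆ Y ((extChartAt (𝓡 (n + 1)) p).symm x)
      - g.pairing X ⁅ξ, Y⁆ ((extChartAt (𝓡 (n + 1)) p).symm x) =
    CoordKilling.lieForm (g.inChart p) (ξ.inChart p) x (X.inChart p x) (Y.inChart p x) := by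
  rw [g.pairing_chart_symm _ _ hx, g.pairing_chart_symm _ _ hx, inChart_bracket _ _ hx,
    inChart_bracket _ _ hx, ← chartDeriv_inChart ξ hx, g.mvfderiv_pairing _ _ hx,
    CoordKilling.fderiv_apply_apply ((g.contDiffAt_inChart hx).differentiableAt (by simp))
      ((X.contDiffAt_inChart hx).differentiableAt (by simp))
      ((Y.contDiffAt_inChart hx).differentiableAt (by simp))]
  simp only [CoordKilling.lieForm, lieBracket, map_sub, sub_apply]
  ring

theorem IsKilling.lieForm_eq_zero [T2Space M] {g : LorentzianMetric n M} {ξ : SmoothVF n M}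
    (h : g.IsKilling ξ) (hx : x ∈ (extChartAt (𝓡 (n + 1)) p).target)
    (v w : EuclideanSpace ℝ (Fin (n + 1))) :
    CoordKilling.lieForm (g.inChart p) (ξ.inChart p) x v w = 0 := by
  obtain ⟨X, rfl⟩ := exists_inChart_eq hx v
  obtain ⟨Y, rfl⟩ := exists_inChart_eq hx w
  rw [← g.lie_pairing_eq ξ X Y hx]
  exact h X Y _

/-- It suffices to check the Killing equation at the centre of each chart. -/
theorem isKilling_of_lieForm_eq_zero {ξ : SmoothVF n M}
    (h : ∀ p : M, ∀ v w, CoordKilling.lieForm (g.inChart p) (ξ.inChart p)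
      (extChartAt (𝓡 (n + 1)) p p) v w = 0) : g.IsKilling ξ := by
  intro X Y p
  have := g.lie_pairing_eq ξ X Y (mem_extChartAt_target (I := 𝓡 (n + 1)) p)
  rw [h] at this
  rwa [extChartAt_to_inv] at this

end LorentzianMetric

/-! ### Embedded hypersurfaces -/

section Hypersurfaces

open Filter Topology SmoothVF

variable {n : ℕ} {M : Type*} [TopologicalSpace M]
  [ChartedSpace (EuclideanSpace ℝ (Fin (n + 1))) M]

/-- Every point lies in the image of some inverse chart. Replacing `q` by `φ⁻¹ x` avoids
transporting tangent vectors along the identity `φ⁻¹ (φ q) = q`. -/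
theorem exists_chart_symm_eq (q : M) : ∃ (p : M) (x : EuclideanSpace ℝ (Fin (n + 1))),
    x ∈ (extChartAt (𝓡 (n + 1)) p).target ∧ (extChartAt (𝓡 (n + 1)) p).symm x = q :=
  ⟨q, extChartAt (𝓡 (n + 1)) q q, mem_extChartAt_target q, extChartAt_to_inv q⟩

theorem tendsto_chart_symm {p : M} {x : EuclideanSpace ℝ (Fin (n + 1))}
    (hx : x ∈ (extChartAt (𝓡 (n + 1)) p).target) :
    Tendsto (extChartAt (𝓡 (n + 1)) p).symm (𝓝 x) (𝓝 ((extChartAt (𝓡 (n + 1)) p).symm x)) :=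
  continuousAt_extChartAt_symm'' hx

theorem tendsto_chart {p : M} {x : EuclideanSpace ℝ (Fin (n + 1))}
    (hx : x ∈ (extChartAt (𝓡 (n + 1)) p).target) :
    Tendsto (extChartAt (𝓡 (n + 1)) p) (𝓝 ((extChartAt (𝓡 (n + 1)) p).symm x)) (𝓝 x) := by
  have := continuousAt_extChartAt' (I := 𝓡 (n + 1)) ((extChartAt (𝓡 (n + 1)) p).map_target hx)
  rwa [ContinuousAt, (extChartAt (𝓡 (n + 1)) p).right_inv hx] at this

theorem eventually_chart_symm_iff {p : M} {x : EuclideanSpace ℝ (Fin (n + 1))}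
    (hx : x ∈ (extChartAt (𝓡 (n + 1)) p).target) {P : M → Prop} :
    (∀ᶠ y in 𝓝 x, P ((extChartAt (𝓡 (n + 1)) p).symm y)) ↔
      ∀ᶠ q in 𝓝 ((extChartAt (𝓡 (n + 1)) p).symm x), P q := by
  refine ⟨fun h ↦ ?_, fun h ↦ (tendsto_chart_symm hx).eventually h⟩
  filter_upwards [(tendsto_chart hx).eventually h, (isOpen_extChartAt_source p).mem_nhds
    ((extChartAt (𝓡 (n + 1)) p).map_target hx)] with q hq hq'
  rwa [(extChartAt (𝓡 (n + 1)) p).left_inv hq'] at hq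

namespace IsDefiningFunction

variable {S S' U W : Set M} {f : M → ℝ}

theorem congr (h : IsDefiningFunction (n := n) S U f) (hW : IsOpen W) (hWU : W ⊆ U)
    (hS : ∀ q ∈ W, q ∈ S ↔ q ∈ S') : IsDefiningFunction (n := n) S' W f :=
  ⟨hW, h.2.1.mono hWU, fun q hq ↦ h.2.2.1 q (hWU hq),
    fun q hq ↦ (hS q hq).symm.trans (h.2.2.2 q (hWU hq))⟩

theorem contMDiffAt (h : IsDefiningFunction (n := n) S U f) {q : M} (hq : q ∈ U) :
    ContMDiffAt (𝓡 (n + 1)) 𝓘(ℝ, ℝ) ∞ f q :=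
  h.2.1.contMDiffAt (h.1.mem_nhds hq)

/-- An embedded hypersurface is locally closed. -/
theorem mem_iff_mem_closure (h : IsDefiningFunction (n := n) S U f) {q : M} (hq : q ∈ U) :
    q ∈ S ↔ q ∈ closure S := by
  refine ⟨fun h ↦ subset_closure h, fun hcl ↦ (h.2.2.2 q hq).2 ?_⟩
  by_contra hne
  have h1 : ∀ᶠ r in 𝓝 q, r ∈ U ∧ f r ≠ 0 :=
    (h.1.eventually_mem hq).and ((h.contMDiffAt hq).continuousAt.eventually_ne hne)
  obtain ⟨r, ⟨hrU, hr⟩, hrS⟩ := mem_closure_iff_frequently.1 hcl |>.and_eventually h1 |>.exists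
    |>.imp fun r hr ↦ And.intro hr.2 hr.1
  exact hr ((h.2.2.2 r hrU).1 hrS)

variable {p : M} {x : EuclideanSpace ℝ (Fin (n + 1))}

theorem eventually_chart (h : IsDefiningFunction (n := n) S U f)
    (hx : x ∈ (extChartAt (𝓡 (n + 1)) p).target) (hxU : (extChartAt (𝓡 (n + 1)) p).symm x ∈ U) :
    ∀ᶠ y in 𝓝 x, y ∈ (extChartAt (𝓡 (n + 1)) p).target ∧
      (extChartAt (𝓡 (n + 1)) p).symm y ∈ U :=
  ((isOpen_extChartAt_target p).eventually_mem hx).and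
    ((tendsto_chart_symm hx).eventually (h.1.mem_nhds hxU))

variable [IsManifold (𝓡 (n + 1)) ∞ M]

theorem contDiffAt_comp (h : IsDefiningFunction (n := n) S U f)
    (hx : x ∈ (extChartAt (𝓡 (n + 1)) p).target) (hxU : (extChartAt (𝓡 (n + 1)) p).symm x ∈ U) :
    ContDiffAt ℝ ∞ (f ∘ (extChartAt (𝓡 (n + 1)) p).symm) x :=
  ((h.contMDiffAt hxU).comp x (contMDiffAt_chart_symm hx)).contDiffAt

theorem mvfderiv_chartDeriv (h : IsDefiningFunction (n := n) S U f)
    (hx : x ∈ (extChartAt (𝓡 (n + 1)) p).target) (hxU : (extChartAt (𝓡 (n + 1)) p).symm x ∈ U)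
    (v : EuclideanSpace ℝ (Fin (n + 1))) :
    mvfderiv (𝓡 (n + 1)) f ((extChartAt (𝓡 (n + 1)) p).symm x) (chartDeriv n p x v) =
      fderiv ℝ (f ∘ (extChartAt (𝓡 (n + 1)) p).symm) x v :=
  SmoothVF.mvfderiv_chartDeriv hx ((h.contMDiffAt hxU).mdifferentiableAt (by simp)) v

theorem fderiv_comp_ne_zero (h : IsDefiningFunction (n := n) S U f)
    (hx : x ∈ (extChartAt (𝓡 (n + 1)) p).target) (hxU : (extChartAt (𝓡 (n + 1)) p).symm x ∈ U) :
    fderiv ℝ (f ∘ (extChartAt (𝓡 (n + 1)) p).symm) x ≠ 0 := by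
  intro h0
  refine h.2.2.1 _ hxU ?_
  ext v
  obtain ⟨v, rfl⟩ := chartDeriv_surjective hx v
  rw [h.mvfderiv_chartDeriv hx hxU, h0]
  rfl

/-- The tangent space of a hypersurface is the kernel of the differential of any one of its local
defining functions. -/
theorem isTangentTo_iff (h : IsDefiningFunction (n := n) S U f) {q : M} (hqU : q ∈ U)
    (hqS : q ∈ S) (v : TangentSpace (𝓡 (n + 1)) q) :
    IsTangentTo S q v ↔ mvfderiv (𝓡 (n + 1)) f q v = 0 := by
  refine ⟨fun hv ↦ hv U f hqU h, fun hv U' f' hqU' h' ↦ ?_⟩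
  obtain ⟨p, x, hx, rfl⟩ := exists_chart_symm_eq (n := n) q
  obtain ⟨v, rfl⟩ := chartDeriv_surjective hx v
  rw [h.mvfderiv_chartDeriv hx hqU] at hv
  rw [h'.mvfderiv_chartDeriv hx hqU']
  refine CoordKilling.fderiv_eq_zero_of_eq_zero_on_level
    ((h.contDiffAt_comp hx hqU).of_le (by simp)) ((h'.contDiffAt_comp hx hqU').of_le (by simp))
    ((h.2.2.2 _ hqU).1 hqS) (h.fderiv_comp_ne_zero hx hqU) ?_ hv
  filter_upwards [h.eventually_chart hx hqU, h'.eventually_chart hx hqU'] with y hy hy' hfy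
  exact (h'.2.2.2 _ hy'.2).1 ((h.2.2.2 _ hy.2).2 hfy)

end IsDefiningFunction

theorem hypersurfaceInterior_subset (C : Set M) : hypersurfaceInterior n C ⊆ C := fun _ h ↦ h.1

theorem IsDefiningFunction.hypersurfaceInterior {C U : Set M} {f : M → ℝ}
    (h : IsDefiningFunction (n := n) C U f) :
    IsDefiningFunction (n := n) (hypersurfaceInterior n C) U f :=
  h.congr h.1 subset_rfl fun _ hq ↦ ⟨fun hC ↦ ⟨hC, U, f, hq, h⟩, fun h' ↦ h'.1⟩

theorem IsEmbeddedHypersurface.exists_closure {S : Set M} (hS : IsEmbeddedHypersurface n S) {q : M}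
    (hq : q ∈ S) : ∃ (U : Set M) (f : M → ℝ), q ∈ U ∧ IsDefiningFunction (n := n) S U f ∧
      IsDefiningFunction (n := n) (closure S) U f := by
  obtain ⟨U, f, hqU, hf⟩ := hS q hq
  exact ⟨U, f, hqU, hf, hf.congr hf.1 subset_rfl fun r hr ↦ hf.mem_iff_mem_closure hr⟩

theorem exists_isDefiningFunction_hypersurfaceInterior {C : Set M} {q : M}
    (hq : q ∈ hypersurfaceInterior n C) : ∃ (U : Set M) (f : M → ℝ), q ∈ U ∧
      IsDefiningFunction (n := n) (hypersurfaceInterior n C) U f := by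
  obtain ⟨-, U, f, hqU, hf⟩ := hq
  exact ⟨U, f, hqU, hf.hypersurfaceInterior⟩

theorem IsEmbeddedHypersurface.subset_hypersurfaceInterior {S : Set M}
    (hS : IsEmbeddedHypersurface n S) : S ⊆ hypersurfaceInterior n (closure S) := fun q hq ↦ by
  obtain ⟨U, f, hqU, -, hf⟩ := hS.exists_closure hq
  exact ⟨subset_closure hq, U, f, hqU, hf⟩

theorem isTangentTo_hypersurfaceInterior_iff [IsManifold (𝓡 (n + 1)) ∞ M] {S : Set M}
    (hS : IsEmbeddedHypersurface n S) {q : M} (hq : q ∈ S) (v : TangentSpace (𝓡 (n + 1)) q) :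
    IsTangentTo (hypersurfaceInterior n (closure S)) q v ↔ IsTangentTo S q v := by
  obtain ⟨U, f, hqU, hf, hf'⟩ := hS.exists_closure hq
  rw [hf.isTangentTo_iff hqU hq, hf'.hypersurfaceInterior.isTangentTo_iff hqU
    (hS.subset_hypersurfaceInterior hq)]

end Hypersurfaces

/-! ### Killing fields are determined by their first jet -/

namespace LorentzianMetric

open Filter Topology VectorField SmoothVF

variable {n : ℕ} {M : Type*} [TopologicalSpace M]
  [ChartedSpace (EuclideanSpace ℝ (Fin (n + 1))) M] [IsManifold (𝓡 (n + 1)) ∞ M]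
  {g : LorentzianMetric n M} {ξ η : SmoothVF n M} {p : M} {x : EuclideanSpace ℝ (Fin (n + 1))}

theorem _root_.SmoothVF.inChart_eq_zero_iff (X : SmoothVF n M)
    (hx : x ∈ (extChartAt (𝓡 (n + 1)) p).target) :
    X.inChart p x = 0 ↔ X ((extChartAt (𝓡 (n + 1)) p).symm x) = 0 := by
  rw [← chartDeriv_inChart X hx]
  exact ⟨fun h ↦ by rw [h, map_zero], fun h ↦ chartDeriv_injective hx (by rw [h, map_zero])⟩

theorem _root_.SmoothVF.eventually_inChart_eq_zero_iff (X : SmoothVF n M)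
    (hx : x ∈ (extChartAt (𝓡 (n + 1)) p).target) :
    (∀ᶠ y in 𝓝 x, X.inChart p y = 0) ↔
      ∀ᶠ q in 𝓝 ((extChartAt (𝓡 (n + 1)) p).symm x), X q = 0 := by
  rw [← eventually_chart_symm_iff hx]
  refine eventually_congr ?_
  filter_upwards [(isOpen_extChartAt_target p).mem_nhds hx] with y hy
  exact X.inChart_eq_zero_iff hy

/-- On a connected manifold a Killing field whose first jet vanishes at a point is zero. -/
theorem IsKilling.eq_zero_of_jet [T2Space M] [ConnectedSpace M] (hξ : g.IsKilling ξ)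
    (hx : x ∈ (extChartAt (𝓡 (n + 1)) p).target) (h0 : ξ.inChart p x = 0)
    (h1 : fderiv ℝ (ξ.inChart p) x = 0) : ξ = 0 := by
  have hloc : ∀ (p : M) (x), x ∈ (extChartAt (𝓡 (n + 1)) p).target → ξ.inChart p x = 0 →
      fderiv ℝ (ξ.inChart p) x = 0 →
      ∀ᶠ q in 𝓝 ((extChartAt (𝓡 (n + 1)) p).symm x), ξ q = 0 := fun p x hx h0 h1 ↦
    (ξ.eventually_inChart_eq_zero_iff hx).1
      (CoordKilling.eventually_eq_zero_of_jet_eq_zero (isOpen_extChartAt_target p) hx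
        ((g.contDiffOn_inChart p).of_le (by exact WithTop.coe_le_coe.2 le_top))
        ((ξ.contDiffOn_inChart p).of_le (by exact WithTop.coe_le_coe.2 le_top))
        (fun y _ v w ↦ g.inChart_symm v w) (fun y hy v w ↦ hξ.lieForm_eq_zero hy v w)
        (fun v ↦ g.inChart_nondegenerate hx) h0 h1)
  set A : Set M := {q | ∀ᶠ r in 𝓝 q, ξ r = 0} with hA
  have hAo : IsOpen A := isOpen_iff_mem_nhds.2 fun q hq ↦ eventually_eventually_nhds.2 hq
  have hAc : IsClosed A := by
    refine isClosed_of_closure_subset fun q hq ↦ ?_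
    obtain ⟨p, x, hx, rfl⟩ := exists_chart_symm_eq (n := n) q
    -- The first jet vanishes at points arbitrarily close to `x`, hence at `x`.
    have hfr : ∃ᶠ y in 𝓝 x, ξ.inChart p y = 0 ∧ fderiv ℝ (ξ.inChart p) y = 0 := by
      have h2 := mem_closure_iff_frequently.1 hq
      have h3 : ∃ᶠ y in 𝓝 x, (extChartAt (𝓡 (n + 1)) p).symm y ∈ A := fun h ↦
        h2 ((eventually_chart_symm_iff hx (P := fun q ↦ q ∉ A)).1 h)
      refine (h3.and_eventually ((isOpen_extChartAt_target p).mem_nhds hx)).mono ?_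
      rintro y ⟨hyA, hy⟩
      have h4 := (ξ.eventually_inChart_eq_zero_iff hy).2 hyA
      refine ⟨h4.self_of_nhds, ?_⟩
      have h5 : ξ.inChart p =ᶠ[𝓝 y] fun _ ↦ 0 := h4
      rw [h5.fderiv_eq]; simp
    have hc := ξ.contDiffAt_inChart hx
    have hc1 : ContinuousAt (fderiv ℝ (ξ.inChart p)) x :=
      (hc.fderiv_right (m := 1) (by exact WithTop.coe_le_coe.2 le_top)).continuousAt
    refine hloc p x hx ?_ ?_
    · by_contra hne
      exact hfr ((hc.continuousAt.eventually_ne hne).mono fun y hy h ↦ hy h.1)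
    · by_contra hne
      exact hfr ((hc1.eventually_ne hne).mono fun y hy h ↦ hy h.2)
  have hAu : A = univ := IsClopen.eq_univ ⟨hAc, hAo⟩ ⟨_, hloc p x hx h0 h1⟩
  ext q
  have hq : q ∈ A := hAu ▸ mem_univ q
  have hq' : ∀ᶠ r in 𝓝 q, ξ r = 0 := hq
  exact hq'.self_of_nhds

theorem IsKilling.add (hξ : g.IsKilling ξ) (hη : g.IsKilling η) : g.IsKilling (ξ + η) := by
  intro X Y q
  have h1 := hξ X Y q
  have h2 := hη X Y q
  simp only [pairing, add_lie, ContMDiffSection.coe_add, Pi.add_apply, map_add,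
    add_apply] at h1 h2 ⊢
  linear_combination h1 + h2

theorem IsKilling.smul (hξ : g.IsKilling ξ) (c : ℝ) : g.IsKilling (c • ξ) := by
  intro X Y q
  have h1 := hξ X Y q
  simp only [pairing, smul_lie, ContMDiffSection.coe_smul, Pi.smul_apply, map_smul,
    smul_apply, smul_eq_mul] at h1 ⊢
  linear_combination c * h1

theorem isKilling_zero : g.IsKilling 0 := by
  intro X Y q
  simp [pairing]

theorem IsKilling.lie [T2Space M] (hξ : g.IsKilling ξ) (hη : g.IsKilling η) :
    g.IsKilling ⁅ξ, η⁆ := by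
  refine g.isKilling_of_lieForm_eq_zero fun p v w ↦ ?_
  set x := extChartAt (𝓡 (n + 1)) p p with hxdef
  have hx : x ∈ (extChartAt (𝓡 (n + 1)) p).target := mem_extChartAt_target p
  have hT := (isOpen_extChartAt_target (I := 𝓡 (n + 1)) p).mem_nhds hx
  have heq : (⁅ξ, η⁆ : SmoothVF n M).inChart p =ᶠ[𝓝 x]
      lieBracket ℝ (ξ.inChart p) (η.inChart p) := by
    filter_upwards [hT] with y hy using inChart_bracket ξ η hy
  have h := CoordKilling.lieForm_lieBracket
    ((g.contDiffAt_inChart hx).of_le (by exact WithTop.coe_le_coe.2 le_top))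
    ((ξ.contDiffAt_inChart hx).of_le (by exact WithTop.coe_le_coe.2 le_top))
    ((η.contDiffAt_inChart hx).of_le (by exact WithTop.coe_le_coe.2 le_top))
    (by filter_upwards [hT] with y hy using hξ.lieForm_eq_zero hy)
    (by filter_upwards [hT] with y hy using hη.lieForm_eq_zero hy) v w
  rw [CoordKilling.lieForm] at h ⊢
  rwa [heq.fderiv_eq, heq.eq_of_nhds]

end LorentzianMetric

/-! ### Killing fields normal to a null hypersurface -/

namespace LorentzianMetric

set_option maxSynthPendingDepth 3

open Filter Topology VectorField SmoothVF

variable {n : ℕ} {M : Type*} [TopologicalSpace M]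
  [ChartedSpace (EuclideanSpace ℝ (Fin (n + 1))) M] [IsManifold (𝓡 (n + 1)) ∞ M]
  {g : LorentzianMetric n M} {ξ η ζ : SmoothVF n M} {p q : M}
  {x : EuclideanSpace ℝ (Fin (n + 1))} {H S : Set M}

/-- The Killing fields that are tangent and normal to the interior of the closure of `H`. For a
multiple Killing horizon `H`, they turn out to be the elements of `𝓐_H`. -/
def normalKilling (g : LorentzianMetric n M) (H : Set M) : Submodule ℝ (SmoothVF n M) where
  carrier := {ξ | g.IsKilling ξ ∧ ∀ q ∈ hypersurfaceInterior n (closure H),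
    IsTangentTo (hypersurfaceInterior n (closure H)) q (ξ q) ∧
      ∀ v, IsTangentTo (hypersurfaceInterior n (closure H)) q v → g.inner q (ξ q) v = 0}
  add_mem' {ξ η} hξ hη := by
    refine ⟨hξ.1.add hη.1, fun q hq ↦ ⟨fun U f hqU hf ↦ ?_, fun v hv ↦ ?_⟩⟩
    · have h1 := (hξ.2 q hq).1 U f hqU hf
      have h2 := (hη.2 q hq).1 U f hqU hf
      rw [ContMDiffSection.coe_add, Pi.add_apply, map_add, h1, h2, add_zero]
    · have h1 := (hξ.2 q hq).2 v hv
      have h2 := (hη.2 q hq).2 v hv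
      rw [ContMDiffSection.coe_add, Pi.add_apply, map_add, add_apply, h1, h2, add_zero]
  zero_mem' := ⟨isKilling_zero, fun q _ ↦ ⟨fun U f _ _ ↦ by simp, fun v _ ↦ by simp⟩⟩
  smul_mem' c ξ hξ := by
    refine ⟨hξ.1.smul c, fun q hq ↦ ⟨fun U f hqU hf ↦ ?_, fun v hv ↦ ?_⟩⟩
    · have h1 := (hξ.2 q hq).1 U f hqU hf
      rw [ContMDiffSection.coe_smul, Pi.smul_apply, map_smul, h1, smul_zero]
    · have h1 := (hξ.2 q hq).2 v hv
      rw [ContMDiffSection.coe_smul, Pi.smul_apply, map_smul, smul_apply, h1, smul_zero]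

theorem inner_self_basis (b : Module.Basis (Fin (n + 1)) ℝ (TangentSpace (𝓡 (n + 1)) q))
    (hb : ∀ i j, g.inner q (b i) (b j) = if i = j then (if i = 0 then -1 else 1) else 0)
    (v : TangentSpace (𝓡 (n + 1)) q) :
    g.inner q v v = -(b.repr v 0) ^ 2 + ∑ i : Fin n, (b.repr v i.succ) ^ 2 := by
  conv_lhs => rw [← b.sum_repr v]
  simp only [map_sum, map_smul, sum_apply, smul_apply, hb]
  simp only [smul_eq_mul, mul_ite, mul_zero, Finset.sum_ite_eq', Finset.mem_univ, if_true]
  rw [Fin.sum_univ_succ]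
  simp only [if_true, Fin.succ_ne_zero, if_false]
  congr 1
  · ring
  · exact Finset.sum_congr rfl fun i _ ↦ by ring

/-- Orthogonal null vectors are proportional. -/
theorem exists_eq_smul_of_null {k v : TangentSpace (𝓡 (n + 1)) q} (hk0 : k ≠ 0)
    (hk : g.inner q k k = 0) (hv : g.inner q v v = 0) (hkv : g.inner q k v = 0) :
    ∃ c : ℝ, v = c • k := by
  obtain ⟨b, hb⟩ := g.signature q
  have key : ∀ m : TangentSpace (𝓡 (n + 1)) q, g.inner q m m = 0 → b.repr m 0 = 0 → m = 0 := by
    intro m hm h0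
    rw [inner_self_basis b hb, h0] at hm
    have hs : ∑ i : Fin n, (b.repr m i.succ) ^ 2 = 0 := by simpa using hm
    rw [Finset.sum_eq_zero_iff_of_nonneg fun i _ ↦ sq_nonneg _] at hs
    refine b.repr.injective (Finsupp.ext fun i ↦ ?_)
    refine Fin.cases ?_ (fun i ↦ ?_) i
    · simpa using h0
    · simpa using hs i (Finset.mem_univ i)
  have hk00 : b.repr k 0 ≠ 0 := fun h ↦ hk0 (key k hk h)
  refine ⟨b.repr v 0 / b.repr k 0, sub_eq_zero.1 (key _ ?_ ?_)⟩
  · have hvk : g.inner q v k = 0 := by rw [g.symm]; exact hkv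
    simp only [map_sub, map_smul, sub_apply, smul_apply, hk, hv, hkv, hvk]
    simp
  · simp [hk00]

/-- On its Killing horizon, a Killing field is normal to the horizon. -/
theorem IsKillingHorizon.inner_eq_zero (h : g.IsKillingHorizon ξ S) (hq : q ∈ S)
    {v : TangentSpace (𝓡 (n + 1)) q} (hv : IsTangentTo S q v) : g.inner q (ξ q) v = 0 := by
  obtain ⟨k, hk0, hkt, hk⟩ := h.nullHypersurface.2 q hq
  obtain ⟨c, hc⟩ := exists_eq_smul_of_null hk0 (hk k hkt) (h.null q hq) (hk _ (h.tangent q hq))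
  rw [hc, map_smul, smul_apply, hk v hv, smul_zero]

theorem IsKillingHorizon.subset (h : g.IsKillingHorizon ξ S) (hSH : closure S = closure H) :
    S ⊆ hypersurfaceInterior n (closure H) :=
  hSH ▸ h.nullHypersurface.1.subset_hypersurfaceInterior

/-- In both cases of the definition of a Killing horizon, the interior of its closure is
connected. -/
theorem IsKillingHorizon.isConnected (h : g.IsKillingHorizon ξ S)
    (hSH : closure S = closure H) : IsConnected (hypersurfaceInterior n (closure H)) := by
  rcases h.connected with hS | hS
  · exact hS.subset_closure (h.subset hSH) (hSH ▸ hypersurfaceInterior_subset (closure S))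
  · exact hSH ▸ hS

theorem IsKillingHorizon.nonempty (h : g.IsKillingHorizon ξ S) : S.Nonempty := by
  rw [← closure_nonempty_iff]
  exact (h.isConnected rfl).nonempty.mono (hypersurfaceInterior_subset _)

/-- A Killing field with a Killing horizon `S` is tangent and normal to the interior of the closure
of `S`, since it is so on the dense subset `S`. -/
theorem IsKillingHorizon.mem_normalKilling (h : g.IsKillingHorizon ξ S)
    (hSH : closure S = closure H) : ξ ∈ g.normalKilling H := by
  refine ⟨h.killing, fun q hq ↦ ?_⟩
  obtain ⟨U, f, hqU, hf⟩ := exists_isDefiningFunction_hypersurfaceInterior hq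
  have hqS : q ∈ closure S := hSH ▸ hypersurfaceInterior_subset _ hq
  obtain ⟨p, x, hx, rfl⟩ := exists_chart_symm_eq (n := n) q
  have hfr : ∃ᶠ y in 𝓝 x, (extChartAt (𝓡 (n + 1)) p).symm y ∈ S := fun hne ↦
    mem_closure_iff_frequently.1 hqS ((eventually_chart_symm_iff hx (P := fun q ↦ q ∉ S)).1 hne)
  set F := f ∘ (extChartAt (𝓡 (n + 1)) p).symm with hF
  have hpt : ∃ᶠ y in 𝓝 x, fderiv ℝ F y (ξ.inChart p y) = 0 ∧
      ∀ v, fderiv ℝ F y v = 0 → g.inChart p y (ξ.inChart p y) v = 0 := by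
    refine (hfr.and_eventually (hf.eventually_chart hx hqU)).mono ?_
    rintro y ⟨hyS, hy, hyU⟩
    have htan : ∀ v, IsTangentTo S ((extChartAt (𝓡 (n + 1)) p).symm y) (chartDeriv n p y v) ↔
        fderiv ℝ F y v = 0 := fun v ↦ by
      rw [← isTangentTo_hypersurfaceInterior_iff h.nullHypersurface.1 hyS, hSH,
        hf.isTangentTo_iff hyU (h.subset hSH hyS), hf.mvfderiv_chartDeriv hy hyU]
    refine ⟨?_, fun v hv ↦ ?_⟩
    · rw [← htan, chartDeriv_inChart ξ hy]
      exact h.tangent _ hyS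
    · rw [inChart_apply, chartDeriv_inChart ξ hy]
      exact h.inner_eq_zero hyS ((htan v).2 hv)
  have hFc : ContinuousAt (fderiv ℝ F) x :=
    ((hf.contDiffAt_comp hx hqU).fderiv_right (m := 1)
      (by exact WithTop.coe_le_coe.2 le_top)).continuousAt
  have hξc : ContinuousAt (ξ.inChart p) x := (ξ.contDiffAt_inChart hx).continuousAt
  have hgc : ContinuousAt (g.inChart p) x := (g.contDiffAt_inChart hx).continuousAt
  -- Both conditions are closed, so that they persist at `x`.
  have h1 : fderiv ℝ F x (ξ.inChart p x) = 0 := by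
    by_contra hne
    exact hpt (((hFc.clm_apply hξc).eventually_ne hne).mono fun y hy h ↦ hy h.1)
  have h2 : ∀ v, fderiv ℝ F x v = 0 → g.inChart p x (ξ.inChart p x) v = 0 := by
    intro v hv
    obtain ⟨e, he⟩ : ∃ e, fderiv ℝ F x e ≠ 0 := by
      by_contra! h'
      exact hf.fderiv_comp_ne_zero hx hqU (ContinuousLinearMap.ext h')
    have hgv : ∀ v, ContinuousAt (fun y ↦ g.inChart p y (ξ.inChart p y) v) x := fun v ↦
      (hgc.clm_apply hξc).clm_apply continuousAt_const
    have hFv : ∀ v, ContinuousAt (fun y ↦ fderiv ℝ F y v) x := fun v ↦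
      hFc.clm_apply continuousAt_const
    have h3 : g.inChart p x (ξ.inChart p x) v * fderiv ℝ F x e -
        g.inChart p x (ξ.inChart p x) e * fderiv ℝ F x v = 0 := by
      by_contra hne
      refine hpt (((((hgv v).mul (hFv e)).sub ((hgv e).mul (hFv v))).eventually_ne hne).mono
        fun y hy h ↦ hy ?_)
      obtain ⟨c, hc⟩ := CoordKilling.exists_eq_mul_of_ker_le (ℓ := (fderiv ℝ F y).toLinearMap)
        (β := (g.inChart p y (ξ.inChart p y)).toLinearMap) h.2
      simp only [ContinuousLinearMap.coe_coe] at hc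
      simp only [Pi.sub_apply, Pi.mul_apply, hc]
      ring
    rw [hv, mul_zero, sub_zero] at h3
    exact (mul_eq_zero.1 h3).resolve_right he
  refine ⟨?_, fun v hv ↦ ?_⟩
  · rw [hf.isTangentTo_iff hqU hq, ← chartDeriv_inChart ξ hx, hf.mvfderiv_chartDeriv hx hqU, h1]
  · obtain ⟨v, rfl⟩ := chartDeriv_surjective hx v
    rw [hf.isTangentTo_iff hqU hq, hf.mvfderiv_chartDeriv hx hqU] at hv
    rw [← chartDeriv_inChart ξ hx, ← inChart_apply]
    exact h2 v hv

/-- The conditions defining `normalKilling`, in a chart. -/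
theorem normalKilling_inChart (hξ : ξ ∈ g.normalKilling H) {U : Set M} {f : M → ℝ}
    (hf : IsDefiningFunction (n := n) (hypersurfaceInterior n (closure H)) U f)
    (hx : x ∈ (extChartAt (𝓡 (n + 1)) p).target)
    (hxU : (extChartAt (𝓡 (n + 1)) p).symm x ∈ U)
    (hfx : f ((extChartAt (𝓡 (n + 1)) p).symm x) = 0) :
    fderiv ℝ (f ∘ (extChartAt (𝓡 (n + 1)) p).symm) x (ξ.inChart p x) = 0 ∧
      ∀ v, fderiv ℝ (f ∘ (extChartAt (𝓡 (n + 1)) p).symm) x v = 0 →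
        g.inChart p x (ξ.inChart p x) v = 0 := by
  have hq := (hf.2.2.2 _ hxU).2 hfx
  obtain ⟨h1, h2⟩ := hξ.2 _ hq
  refine ⟨?_, fun v hv ↦ ?_⟩
  · rwa [hf.isTangentTo_iff hxU hq, ← chartDeriv_inChart ξ hx,
      hf.mvfderiv_chartDeriv hx hxU] at h1
  · have := h2 (chartDeriv n p x v)
      (by rwa [hf.isTangentTo_iff hxU hq, hf.mvfderiv_chartDeriv hx hxU])
    rwa [← chartDeriv_inChart ξ hx, ← inChart_apply] at this

/-- The points where a nonzero Killing field does not vanish are dense in a hypersurface. -/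
theorem IsKilling.subset_closure_ne_zero [T2Space M] [ConnectedSpace M] (hξ : g.IsKilling ξ)
    (hξ0 : ξ ≠ 0) :
    hypersurfaceInterior n (closure H) ⊆
      closure {q | q ∈ hypersurfaceInterior n (closure H) ∧ ξ q ≠ 0} := by
  intro q hq
  by_contra hcl
  rw [mem_closure_iff_frequently, not_frequently] at hcl
  obtain ⟨U, f, hqU, hf⟩ := exists_isDefiningFunction_hypersurfaceInterior hq
  obtain ⟨p, x, hx, rfl⟩ := exists_chart_symm_eq (n := n) q
  have hvan : ∀ᶠ y in 𝓝 x, (f ∘ (extChartAt (𝓡 (n + 1)) p).symm) y = 0 → ξ.inChart p y = 0 := by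
    filter_upwards [(eventually_chart_symm_iff hx).2 hcl, hf.eventually_chart hx hqU]
      with y hy hyU hfy
    rw [inChart_eq_zero_iff _ hyU.1]
    by_contra hne
    exact hy ⟨(hf.2.2.2 _ hyU.2).2 hfy, hne⟩
  have hfx : (f ∘ (extChartAt (𝓡 (n + 1)) p).symm) x = 0 := (hf.2.2.2 _ hqU).1 hq
  refine hξ0 (hξ.eq_zero_of_jet hx (hvan.self_of_nhds hfx) ?_)
  exact CoordKilling.fderiv_eq_zero_of_killing_of_level
    ((ξ.contDiffAt_inChart hx).of_le (by simp)) g.inChart_symm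
    (fun v ↦ g.inChart_nondegenerate hx) ((hf.contDiffAt_comp hx hqU).of_le (by simp)) hfx
    (hf.fderiv_comp_ne_zero hx hqU) (fun v w ↦ hξ.lieForm_eq_zero hx v w) hvan

/-- A nonzero Killing field that is tangent and normal to the interior of the closure of `H` has a
Killing horizon, which consists of all points of this interior where the field does not
vanish. -/
theorem exists_isKillingHorizon [T2Space M] [ConnectedSpace M] (hH : IsEmbeddedHypersurface n H)
    (hconn : IsConnected (hypersurfaceInterior n (closure H))) (hξ : ξ ∈ g.normalKilling H)
    (hξ0 : ξ ≠ 0) : ∃ S, g.IsKillingHorizon ξ S ∧ closure S = closure H := by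
  set I := hypersurfaceInterior n (closure H) with hI
  set S := {q | q ∈ I ∧ ξ q ≠ 0} with hS
  have hcl : closure S = closure H := by
    refine subset_antisymm ?_ ?_
    · exact closure_minimal (fun q (hq : q ∈ S) ↦ hypersurfaceInterior_subset (n := n) _ hq.1)
        isClosed_closure
    · exact closure_minimal (hH.subset_hypersurfaceInterior.trans
        (hξ.1.subset_closure_ne_zero hξ0)) isClosed_closure
  have hopen : ∀ q, ξ q ≠ 0 → ∀ᶠ r in 𝓝 q, ξ r ≠ 0 := by
    intro q hq
    obtain ⟨p, x, hx, rfl⟩ := exists_chart_symm_eq (n := n) q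
    rw [← eventually_chart_symm_iff hx]
    filter_upwards [(ξ.contDiffAt_inChart hx).continuousAt.eventually_ne
      (mt (ξ.inChart_eq_zero_iff hx).1 hq), (isOpen_extChartAt_target p).mem_nhds hx]
      with y hy hyT using mt (ξ.inChart_eq_zero_iff hyT).2 hy
  have hOpen : IsOpen {q | ξ q ≠ 0} := isOpen_iff_mem_nhds.2 hopen
  have hdef : ∀ q ∈ S, ∃ (U : Set M) (f : M → ℝ), q ∈ U ∧ IsDefiningFunction (n := n) S U f ∧
      IsDefiningFunction (n := n) I U f := by
    intro q hq
    obtain ⟨U, f, hqU, hf⟩ := exists_isDefiningFunction_hypersurfaceInterior hq.1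
    have hW : IsOpen (U ∩ {q | ξ q ≠ 0}) := hf.1.inter hOpen
    exact ⟨U ∩ {q | ξ q ≠ 0}, f, ⟨hqU, hq.2⟩, hf.congr hW inter_subset_left
      fun r hr ↦ ⟨fun h ↦ ⟨h, hr.2⟩, fun h ↦ h.1⟩, hf.congr hW inter_subset_left
      fun r _ ↦ Iff.rfl⟩
  have htan : ∀ q ∈ S, ∀ v, IsTangentTo (n := n) S q v ↔ IsTangentTo (n := n) I q v := by
    intro q hq v
    obtain ⟨U, f, hqU, hf, hf'⟩ := hdef q hq
    rw [hf.isTangentTo_iff hqU hq, hf'.isTangentTo_iff hqU hq.1]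
  have ht : ∀ q ∈ S, IsTangentTo S q (ξ q) := fun q hq ↦ (htan q hq _).2 (hξ.2 q hq.1).1
  refine ⟨S, ⟨hξ.1, ⟨fun q hq ↦ ?_, fun q hq ↦ ⟨ξ q, hq.2, ht q hq, fun v hv ↦ ?_⟩⟩,
    fun q hq ↦ (hξ.2 q hq.1).2 _ (hξ.2 q hq.1).1, fun q hq ↦ hq.2, ht, Or.inr (hcl ▸ hconn)⟩, hcl⟩
  · obtain ⟨U, f, hqU, hf, -⟩ := hdef q hq
    exact ⟨U, f, hqU, hf⟩
  · exact (hξ.2 q hq.1).2 v ((htan q hq v).1 hv)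

/-- `𝓐_H` is the linear subspace `normalKilling`. -/
theorem horizonKillingSet_eq [T2Space M] [ConnectedSpace M] (hH : IsEmbeddedHypersurface n H)
    (hconn : IsConnected (hypersurfaceInterior n (closure H))) :
    g.horizonKillingSet H = g.normalKilling H := by
  ext ξ
  refine ⟨?_, fun hξ ↦ ?_⟩
  · rintro (rfl | ⟨S, hS, hSH⟩)
    · exact zero_mem _
    · exact hS.mem_normalKilling hSH
  · by_cases h0 : ξ = 0
    · exact Or.inl h0
    · exact Or.inr (exists_isKillingHorizon hH hconn hξ h0)

/-! ### Surface gravity and the bracket -/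

/-- `κ` is the surface gravity of `ξ` at `q`, relative to a Killing field `ζ` that spans the null
normal of the hypersurface at `q`: `dξ♭ (ζ, ·) = 2 κ g(ζ, ·)` at `q`, where
`dξ♭ (ζ, ·) = g([ζ, ξ], ·) - d(g(ζ, ξ))` as `ζ` is a Killing field. In contrast to the definition
by `grad (g(ξ, ξ)) = -2 κ ξ`, this makes sense where `ξ` vanishes, and is linear in `ξ`. -/
def IsGravityAt (g : LorentzianMetric n M) (ζ : SmoothVF n M) (q : M) (ξ : SmoothVF n M) (κ : ℝ) :
    Prop :=
  ∀ v, g.inner q (⁅ζ, ξ⁆ q) v - mvfderiv (𝓡 (n + 1)) (g.pairing ζ ξ) q v =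
    2 * κ * g.inner q (ζ q) v

theorem isGravityAt_iff_curlForm [T2Space M] (hζ : g.IsKilling ζ)
    (hx : x ∈ (extChartAt (𝓡 (n + 1)) p).target) {κ : ℝ} :
    g.IsGravityAt ζ ((extChartAt (𝓡 (n + 1)) p).symm x) ξ κ ↔
      ∀ v, CoordKilling.curlForm (g.inChart p) (ξ.inChart p) x (ζ.inChart p x) v =
        2 * κ * g.inChart p x (ζ.inChart p x) v := by
  rw [IsGravityAt, (chartDeriv_surjective hx).forall]
  refine forall_congr' fun v ↦ ?_
  rw [g.mvfderiv_pairing _ _ hx, ← chartDeriv_inChart _ hx, ← chartDeriv_inChart _ hx,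
    ← inChart_apply, ← inChart_apply, inChart_bracket _ _ hx,
    CoordKilling.curlForm_apply_killing ((g.contDiffAt_inChart hx).differentiableAt (by simp))
      ((ζ.contDiffAt_inChart hx).differentiableAt (by simp))
      ((ξ.contDiffAt_inChart hx).differentiableAt (by simp))
      (Eventually.of_forall fun y v w ↦ g.inChart_symm v w)
      (fun v w ↦ hζ.lieForm_eq_zero hx v w)]

theorem IsGravityAt.add {κ κ' : ℝ} (h : g.IsGravityAt ζ q ξ κ) (h' : g.IsGravityAt ζ q η κ') :
    g.IsGravityAt ζ q (ξ + η) (κ + κ') := by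
  intro v
  have h1 := h v
  have h2 := h' v
  have h3 : g.pairing ζ (ξ + η) = g.pairing ζ ξ + g.pairing ζ η := by
    ext r; simp [pairing]
  rw [h3, mvfderiv_add ((g.contMDiff_pairing ζ ξ).mdifferentiableAt (by simp))
    ((g.contMDiff_pairing ζ η).mdifferentiableAt (by simp)), lie_add]
  simp only [ContMDiffSection.coe_add, Pi.add_apply, map_add, add_apply]
  linear_combination h1 + h2

theorem IsGravityAt.smul {κ : ℝ} (h : g.IsGravityAt ζ q ξ κ) (c : ℝ) :
    g.IsGravityAt ζ q (c • ξ) (c * κ) := by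
  intro v
  have h1 := h v
  have h3 : g.pairing ζ (c • ξ) = (fun _ : M ↦ c) • g.pairing ζ ξ := by
    ext r; simp [pairing]
  rw [h3, mvfderiv_smul mdifferentiableAt_const
    ((g.contMDiff_pairing ζ ξ).mdifferentiableAt (by simp)), lie_smul, mvfderiv_const]
  simp only [ContMDiffSection.coe_smul, Pi.smul_apply, map_smul, add_apply, smul_apply,
    smul_eq_mul]
  simp
  linear_combination c * h1

theorem IsGravityAt.unique {κ κ' : ℝ} (hζ : ζ q ≠ 0) (h : g.IsGravityAt ζ q ξ κ)
    (h' : g.IsGravityAt ζ q ξ κ') : κ = κ' := by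
  by_contra hne
  refine hζ (g.nondegenerate fun v ↦ ?_)
  have h1 := h v
  rw [h' v] at h1
  have : (κ - κ') * g.inner q (ζ q) v = 0 := by linear_combination -(1 / 2) * h1
  exact (mul_eq_zero.1 this).resolve_left (sub_ne_zero.2 hne)

/-- For `ξ` in `normalKilling`, the two-form `dξ♭` vanishes on pairs of tangent vectors of the
hypersurface. -/
theorem normalKilling_curlForm_eq_zero (hξ : ξ ∈ g.normalKilling H) {U : Set M} {f : M → ℝ}
    (hf : IsDefiningFunction (n := n) (hypersurfaceInterior n (closure H)) U f)
    (hx : x ∈ (extChartAt (𝓡 (n + 1)) p).target)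
    (hxU : (extChartAt (𝓡 (n + 1)) p).symm x ∈ U)
    (hfx : f ((extChartAt (𝓡 (n + 1)) p).symm x) = 0) {u v : EuclideanSpace ℝ (Fin (n + 1))}
    (hu : fderiv ℝ (f ∘ (extChartAt (𝓡 (n + 1)) p).symm) x u = 0)
    (hv : fderiv ℝ (f ∘ (extChartAt (𝓡 (n + 1)) p).symm) x v = 0) :
    CoordKilling.curlForm (g.inChart p) (ξ.inChart p) x u v = 0 := by
  have h2 : (2 : WithTop ℕ∞) ≤ ∞ := WithTop.coe_le_coe.2 le_top
  refine CoordKilling.curlForm_eq_zero_of_conormal ((g.contDiffAt_inChart hx).of_le h2)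
    ((ξ.contDiffAt_inChart hx).of_le h2) ((hf.contDiffAt_comp hx hxU).of_le h2) hfx
    (hf.fderiv_comp_ne_zero hx hxU) ?_ hu hv
  filter_upwards [hf.eventually_chart hx hxU] with y hy hfy
  exact (normalKilling_inChart hξ hf hy.1 hy.2 hfy).2

/-- Where an element `ζ` of `normalKilling` does not vanish, it spans the normal line of the
hypersurface: each covector annihilating the tangent space is a multiple of `g(ζ, ·)`. -/
theorem exists_mul_of_normalKilling (hζ : ζ ∈ g.normalKilling H) {U : Set M} {f : M → ℝ}
    (hf : IsDefiningFunction (n := n) (hypersurfaceInterior n (closure H)) U f)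
    (hx : x ∈ (extChartAt (𝓡 (n + 1)) p).target)
    (hxU : (extChartAt (𝓡 (n + 1)) p).symm x ∈ U)
    (hfx : f ((extChartAt (𝓡 (n + 1)) p).symm x) = 0) (hζ0 : ζ.inChart p x ≠ 0)
    {β : EuclideanSpace ℝ (Fin (n + 1)) →ₗ[ℝ] ℝ}
    (hβ : ∀ v, fderiv ℝ (f ∘ (extChartAt (𝓡 (n + 1)) p).symm) x v = 0 → β v = 0) :
    ∃ c : ℝ, ∀ v, β v = c * g.inChart p x (ζ.inChart p x) v := by
  obtain ⟨a, ha⟩ := CoordKilling.exists_eq_mul_of_ker_le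
    (ℓ := (fderiv ℝ (f ∘ (extChartAt (𝓡 (n + 1)) p).symm) x).toLinearMap)
    (β := (g.inChart p x (ζ.inChart p x)).toLinearMap)
    (normalKilling_inChart hζ hf hx hxU hfx).2
  obtain ⟨b, hb⟩ := CoordKilling.exists_eq_mul_of_ker_le
    (ℓ := (fderiv ℝ (f ∘ (extChartAt (𝓡 (n + 1)) p).symm) x).toLinearMap) hβ
  simp only [ContinuousLinearMap.coe_coe] at ha hb
  have ha0 : a ≠ 0 := by
    rintro rfl
    exact hζ0 (g.inChart_nondegenerate hx fun w ↦ by rw [ha, zero_mul])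
  exact ⟨b / a, fun v ↦ by rw [ha, hb]; field_simp⟩

/-- At a point of the hypersurface, two elements of `normalKilling` are proportional. -/
theorem exists_eq_smul_of_normalKilling (hζ : ζ ∈ g.normalKilling H) (hξ : ξ ∈ g.normalKilling H)
    (hq : q ∈ hypersurfaceInterior n (closure H)) (hζ0 : ζ q ≠ 0) : ∃ c : ℝ, ξ q = c • ζ q := by
  obtain ⟨U, f, hqU, hf⟩ := exists_isDefiningFunction_hypersurfaceInterior hq
  have hfq := (hf.2.2.2 _ hqU).1 hq
  obtain ⟨p, x, hx, rfl⟩ := exists_chart_symm_eq (n := n) q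
  obtain ⟨c, hc⟩ := exists_mul_of_normalKilling hζ hf hx hqU hfq
    (mt (ζ.inChart_eq_zero_iff hx).1 hζ0) (β := (g.inChart p x (ξ.inChart p x)).toLinearMap)
    (normalKilling_inChart hξ hf hx hqU hfq).2
  refine ⟨c, ?_⟩
  rw [← chartDeriv_inChart ζ hx, ← chartDeriv_inChart ξ hx, ← map_smul]
  congr 1
  refine sub_eq_zero.1 (g.inChart_nondegenerate hx fun w ↦ ?_)
  have := hc w
  simp only [ContinuousLinearMap.coe_coe] at this
  simp [this]

/-- The one-form `dξ♭ (ζ, ·)` annihilates the tangent space, so that it is a multiple of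
`g(ζ, ·)`. -/
theorem exists_isGravityAt [T2Space M] (hζ : ζ ∈ g.normalKilling H) (hξ : ξ ∈ g.normalKilling H)
    (hq : q ∈ hypersurfaceInterior n (closure H)) (hζ0 : ζ q ≠ 0) :
    ∃ κ, g.IsGravityAt ζ q ξ κ := by
  obtain ⟨U, f, hqU, hf⟩ := exists_isDefiningFunction_hypersurfaceInterior hq
  have hfq := (hf.2.2.2 _ hqU).1 hq
  obtain ⟨p, x, hx, rfl⟩ := exists_chart_symm_eq (n := n) q
  obtain ⟨c, hc⟩ := exists_mul_of_normalKilling hζ hf hx hqU hfq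
    (mt (ζ.inChart_eq_zero_iff hx).1 hζ0)
    (β := { toFun := CoordKilling.curlForm (g.inChart p) (ξ.inChart p) x (ζ.inChart p x)
            map_add' := fun v w ↦ by
              simp only [CoordKilling.curlForm, map_add, add_apply]; ring
            map_smul' := fun a v ↦ by
              simp only [CoordKilling.curlForm, map_smul, smul_apply, smul_eq_mul,
                RingHom.id_apply]; ring })
    fun v hv ↦ normalKilling_curlForm_eq_zero hξ hf hx hqU hfq
      (normalKilling_inChart hζ hf hx hqU hfq).1 hv
  refine ⟨c / 2, (isGravityAt_iff_curlForm hζ.1 hx).2 fun v ↦ (hc v).trans ?_⟩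
  ring

/-- The bracket of two fields of which one vanishes at the point `q` of the hypersurface. Both sides
are Killing fields on `M`, so that it suffices to compare their first jets at `q`. -/
theorem lie_eq_of_apply_eq_zero [T2Space M] [ConnectedSpace M] {ψ : SmoothVF n M} {κ κ' : ℝ}
    (hζ : ζ ∈ g.normalKilling H) (hξ : ξ ∈ g.normalKilling H) (hψ : ψ ∈ g.normalKilling H)
    (hq : q ∈ hypersurfaceInterior n (closure H)) (hζ0 : ζ q ≠ 0) (hψ0 : ψ q = 0)
    (hκ : g.IsGravityAt ζ q ξ κ) (hκ' : g.IsGravityAt ζ q ψ κ') :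
    ⁅ψ, ξ⁆ = κ • ψ - κ' • ξ := by
  obtain ⟨s, hs⟩ := exists_eq_smul_of_normalKilling hζ hξ hq hζ0
  obtain ⟨U, f, hqU, hf⟩ := exists_isDefiningFunction_hypersurfaceInterior hq
  have hfq := (hf.2.2.2 _ hqU).1 hq
  obtain ⟨p, x, hx, rfl⟩ := exists_chart_symm_eq (n := n) q
  have hT := (isOpen_extChartAt_target (I := 𝓡 (n + 1)) p).mem_nhds hx
  have h2 : (2 : WithTop ℕ∞) ≤ ∞ := WithTop.coe_le_coe.2 le_top
  have h3 : (3 : WithTop ℕ∞) ≤ ∞ := WithTop.coe_le_coe.2 le_top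
  have hs' : ξ.inChart p x = s • ζ.inChart p x := chartDeriv_injective hx (by
    rw [map_smul, chartDeriv_inChart _ hx, chartDeriv_inChart _ hx, hs])
  obtain ⟨hj0, hj1⟩ := CoordKilling.jet_lieBracket (P := ψ.inChart p) (X := ξ.inChart p)
    ((g.contDiffAt_inChart hx).of_le h2)
    ((ξ.contDiffAt_inChart hx).of_le h3) ((ψ.contDiffAt_inChart hx).of_le h3)
    (Eventually.of_forall fun y v w ↦ g.inChart_symm v w)
    (fun v ↦ g.inChart_nondegenerate hx)
    (by filter_upwards [hT] with y hy using fun v w ↦ hξ.1.lieForm_eq_zero hy v w)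
    (by filter_upwards [hT] with y hy using fun v w ↦ hψ.1.lieForm_eq_zero hy v w)
    (hf.fderiv_comp_ne_zero hx hqU) (mt (ζ.inChart_eq_zero_iff hx).1 hζ0)
    (normalKilling_inChart hζ hf hx hqU hfq).2 hs' ((ψ.inChart_eq_zero_iff hx).2 hψ0)
    (fun u v ↦ normalKilling_curlForm_eq_zero hξ hf hx hqU hfq)
    (fun u v ↦ normalKilling_curlForm_eq_zero hψ hf hx hqU hfq)
    ((isGravityAt_iff_curlForm hζ.1 hx).1 hκ) ((isGravityAt_iff_curlForm hζ.1 hx).1 hκ')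
  -- The difference of both sides is a Killing field with vanishing first jet at `q`.
  have hK : g.IsKilling (⁅ψ, ξ⁆ + ((-κ) • ψ + κ' • ξ)) :=
    (hψ.1.lie hξ.1).add ((hψ.1.smul _).add (hξ.1.smul _))
  have heq : (⁅ψ, ξ⁆ : SmoothVF n M).inChart p =ᶠ[𝓝 x]
      lieBracket ℝ (ψ.inChart p) (ξ.inChart p) := by
    filter_upwards [hT] with y hy using inChart_bracket ψ ξ hy
  have hd : ∀ X : SmoothVF n M, DifferentiableAt ℝ (X.inChart p) x := fun X ↦
    (X.contDiffAt_inChart hx).differentiableAt (by simp)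
  have hzero := hK.eq_zero_of_jet hx (by
      rw [inChart_add, inChart_add, inChart_smul, inChart_smul, Pi.add_apply, heq.eq_of_nhds, hj0]
      simp) (by
      rw [inChart_add, inChart_add, inChart_smul, inChart_smul,
        fderiv_add (hd _) (((hd _).const_smul _).add ((hd _).const_smul _)),
        fderiv_add ((hd _).const_smul _) ((hd _).const_smul _), fderiv_const_smul (hd _),
        fderiv_const_smul (hd _), heq.fderiv_eq, hj1]
      module)
  rw [← sub_eq_zero, ← hzero]
  module

/-- The bracket on `normalKilling`, in terms of the surface gravities at any point of the
hypersurface where some element does not vanish. -/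
theorem lie_eq_of_isGravityAt [T2Space M] [ConnectedSpace M] {κ κ' : ℝ}
    (hζ : ζ ∈ g.normalKilling H) (hξ : ξ ∈ g.normalKilling H) (hη : η ∈ g.normalKilling H)
    (hq : q ∈ hypersurfaceInterior n (closure H)) (hζ0 : ζ q ≠ 0)
    (hκ : g.IsGravityAt ζ q ξ κ) (hκ' : g.IsGravityAt ζ q η κ') :
    ⁅ξ, η⁆ = κ' • ξ - κ • η := by
  by_cases hξ0 : ξ q = 0
  · exact lie_eq_of_apply_eq_zero hζ hη hξ hq hζ0 hξ0 hκ' hκ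
  · -- A suitable combination of `ξ` and `η` vanishes at `q`.
    obtain ⟨c, hc⟩ := exists_eq_smul_of_normalKilling hξ hη hq hξ0
    have h := lie_eq_of_apply_eq_zero (ψ := η + (-c) • ξ) hζ hξ
      (add_mem hη (Submodule.smul_mem _ _ hξ)) hq hζ0 (by simp [hc]) hκ (hκ'.add (hκ.smul (-c)))
    rw [add_lie, smul_lie, lie_self, smul_zero, add_zero] at h
    rw [← lie_skew, h]
    module

end LorentzianMetric

/-! ### The Lie algebra of a multiple Killing horizon -/

namespace LorentzianMetric

set_option maxSynthPendingDepth 3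

open Filter Topology VectorField SmoothVF

variable {n : ℕ} {M : Type*} [TopologicalSpace M]
  [ChartedSpace (EuclideanSpace ℝ (Fin (n + 1))) M] [IsManifold (𝓡 (n + 1)) ∞ M]
  {g : LorentzianMetric n M} {ξ ζ : SmoothVF n M} {p q : M} {H : Set M}

/-- A Killing field is determined by its first jet at a point, so that a space of Killing fields
is finite dimensional. -/
theorem finiteDimensional_of_isKilling [T2Space M] [ConnectedSpace M]
    {B : Submodule ℝ (SmoothVF n M)} (hB : ∀ ξ ∈ B, g.IsKilling ξ) (q : M) :
    FiniteDimensional ℝ B := by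
  obtain ⟨p, x, hx, rfl⟩ := exists_chart_symm_eq (n := n) q
  have hd : ∀ X : SmoothVF n M, DifferentiableAt ℝ (X.inChart p) x := fun X ↦
    (X.contDiffAt_inChart hx).differentiableAt (by simp)
  let J : B →ₗ[ℝ] EuclideanSpace ℝ (Fin (n + 1)) ×
      (EuclideanSpace ℝ (Fin (n + 1)) →L[ℝ] EuclideanSpace ℝ (Fin (n + 1))) :=
    { toFun := fun ξ ↦ ((ξ : SmoothVF n M).inChart p x, fderiv ℝ ((ξ : SmoothVF n M).inChart p) x)
      map_add' := fun ξ η ↦ by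
        rw [Submodule.coe_add, inChart_add, fderiv_add (hd _) (hd _)]; rfl
      map_smul' := fun c ξ ↦ by
        rw [Submodule.coe_smul, inChart_smul, fderiv_const_smul (hd _)]; rfl }
  refine FiniteDimensional.of_injective J ((injective_iff_map_eq_zero J).2 fun ξ hξ ↦ ?_)
  exact Subtype.ext ((hB ξ ξ.2).eq_zero_of_jet hx (congrArg Prod.fst hξ) (congrArg Prod.snd hξ))

/-- The surface gravity as a linear functional. -/
theorem exists_linearMap_isGravityAt [T2Space M] (hζ : ζ ∈ g.normalKilling H)
    (hq : q ∈ hypersurfaceInterior n (closure H)) (hζ0 : ζ q ≠ 0) :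
    ∃ κ : g.normalKilling H →ₗ[ℝ] ℝ, ∀ ξ : g.normalKilling H, g.IsGravityAt ζ q ξ (κ ξ) := by
  choose κ hκ using fun ξ : g.normalKilling H ↦ exists_isGravityAt hζ ξ.2 hq hζ0
  exact ⟨{  toFun := κ
            map_add' := fun ξ η ↦ (hκ (ξ + η)).unique hζ0 ((hκ ξ).add (hκ η))
            map_smul' := fun c ξ ↦ (hκ (c • ξ)).unique hζ0 ((hκ ξ).smul c) }, hκ⟩

/-- For `ζ = ξ`, `IsGravityAt` is the usual definition of the surface gravity. -/
theorem isGravityAt_self_iff {κ : ℝ} : g.IsGravityAt ξ q ξ κ ↔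
    ∀ v, mvfderiv (𝓡 (n + 1)) (g.pairing ξ ξ) q v = -2 * κ * g.inner q (ξ q) v := by
  refine forall_congr' fun v ↦ ?_
  rw [lie_self, ContMDiffSection.coe_zero, Pi.zero_apply, map_zero, zero_apply]
  constructor <;> intro h <;> linear_combination -h

/-- The surface gravity of `ζ` does not depend on the point: it can be read off from the bracket
of `ζ` with a linearly independent field. -/
theorem isGravityAt_self [T2Space M] [ConnectedSpace M]
    (hξ : ξ ∈ g.normalKilling H) (hp : p ∈ hypersurfaceInterior n (closure H)) (hξ0 : ξ p ≠ 0)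
    {κ : g.normalKilling H →ₗ[ℝ] ℝ} (hκ : ∀ η : g.normalKilling H, g.IsGravityAt ξ p η (κ η))
    (hdim : 1 < Module.finrank ℝ (g.normalKilling H)) (ζ : g.normalKilling H)
    (hq : q ∈ hypersurfaceInterior n (closure H)) (hζ0 : (ζ : SmoothVF n M) q ≠ 0) :
    g.IsGravityAt ζ q ζ (κ ζ) := by
  have hζ : ζ ≠ 0 := by rintro rfl; exact hζ0 rfl
  obtain ⟨η, hη⟩ := exists_linearIndependent_pair_of_one_lt_finrank hdim hζ
  obtain ⟨a, ha⟩ := exists_isGravityAt ζ.2 ζ.2 hq hζ0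
  obtain ⟨b, hb⟩ := exists_isGravityAt ζ.2 η.2 hq hζ0
  have h1 := lie_eq_of_isGravityAt ζ.2 ζ.2 η.2 hq hζ0 ha hb
  rw [lie_eq_of_isGravityAt hξ ζ.2 η.2 hp hξ0 (hκ ζ) (hκ η)] at h1
  -- The bracket `[ζ, η]` has been computed at `p` and at `q`; compare the coefficients.
  have h2 : (κ η - b) • ζ + (a - κ ζ) • η = 0 := Subtype.ext (by
    rw [← sub_eq_zero] at h1
    push_cast
    rw [← h1]
    module)
  have h3 := (LinearIndependent.pair_iff.1 hη _ _ h2).2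
  rwa [← sub_eq_zero.1 h3]

end LorentzianMetric

theorem mainTheorem2 (n : ℕ) (hn : 1 ≤ n) {M : Type*} [TopologicalSpace M] [T2Space M]
    [SecondCountableTopology M] [ConnectedSpace M]
    [ChartedSpace (EuclideanSpace ℝ (Fin (n + 1))) M] [IsManifold (𝓡 (n + 1)) ∞ M]
    (g : LorentzianMetric n M) (H : Set M) (hH : g.IsMultipleKillingHorizon H) :
    ∃ (A Adeg : LieSubalgebra ℝ (SmoothVF n M)) (κ : A →ₗ[ℝ] ℝ),
      -- the Lie algebra of `H`, of finite order `m = finrank A`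
      (A : Set (SmoothVF n M)) = g.horizonKillingSet H ∧
      FiniteDimensional ℝ A ∧ 2 ≤ Module.finrank ℝ A ∧
      -- surface gravities are constant on every Killing horizon, and linear in the Killing vector
      (∀ (ζ : A) (S : Set M), g.IsKillingHorizon (ζ : SmoothVF n M) S →
        closure S = closure H → g.IsSurfaceGravity (ζ : SmoothVF n M) S (fun _ ↦ κ ζ)) ∧
      -- the Abelian subalgebra of elements with vanishing surface gravity
      (Adeg : Set (SmoothVF n M)) = g.degenerateKillingSet H ∧
      Adeg ≤ A ∧ IsLieAbelian Adeg ∧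
      Module.finrank ℝ A - 1 ≤ Module.finrank ℝ Adeg ∧
      (∀ ζ : A, (ζ : SmoothVF n M) ∈ Adeg ↔ κ ζ = 0) ∧
      -- the remaining generator, when the dimension is exactly `m - 1`
      (Module.finrank ℝ Adeg = Module.finrank ℝ A - 1 →
        ∃ ξ : A, (ξ : SmoothVF n M) ∉ Adeg) ∧
      (Module.finrank ℝ Adeg = Module.finrank ℝ A - 1 →
        ∀ ξ : A, (ξ : SmoothVF n M) ∉ Adeg → κ ξ ≠ 0 ∧
          ∀ η ∈ Adeg, ⁅(ξ : SmoothVF n M), η⁆ = -κ ξ • η) ∧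
      -- essential uniqueness of the nonzero surface gravity
      (∀ ξ : A, κ ξ ≠ 0 → ∀ ζ : A,
        ∃! c : ℝ, ((ζ - c • ξ : A) : SmoothVF n M) ∈ Adeg ∧ κ ζ = c * κ ξ) := by
  obtain ⟨hHnull, m, Ξ, S, hm, hΞ, hS⟩ := hH
  -- Any one of the given horizons provides a point `p` at which the surface gravities are read off.
  have hm0 : 0 < m := by omega
  obtain ⟨h0, h0H⟩ := hS ⟨0, hm0⟩
  obtain ⟨p, hpS⟩ := h0.nonempty
  have hp := h0.subset h0H hpS
  have hconn := h0.isConnected h0H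
  have hξ := h0.mem_normalKilling h0H
  have hξ0 := h0.ne_zero p hpS
  set ξ₀ := Ξ ⟨0, hm0⟩
  obtain ⟨κ, hκ⟩ := LorentzianMetric.exists_linearMap_isGravityAt hξ hp hξ0
  have hlie : ∀ ξ η : g.normalKilling H, ⁅(ξ : SmoothVF n M), (η : SmoothVF n M)⁆ =
      κ η • (ξ : SmoothVF n M) - κ ξ • (η : SmoothVF n M) :=
    fun ξ η ↦ LorentzianMetric.lie_eq_of_isGravityAt hξ ξ.2 η.2 hp hξ0 (hκ ξ) (hκ η)
  have hfin : FiniteDimensional ℝ (g.normalKilling H) :=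
    LorentzianMetric.finiteDimensional_of_isKilling (fun ξ hξ ↦ hξ.1) p
  have hrank : 2 ≤ Module.finrank ℝ (g.normalKilling H) := by
    have hli : LinearIndependent ℝ
        (fun i ↦ (⟨Ξ i, (hS i).1.mem_normalKilling (hS i).2⟩ : g.normalKilling H)) :=
      LinearIndependent.of_comp (g.normalKilling H).subtype hΞ
    simpa using hm.trans (by simpa using hli.fintype_card_le_finrank)
  have hgrav : ∀ (ζ : g.normalKilling H) (S : Set M), g.IsKillingHorizon (ζ : SmoothVF n M) S →
      closure S = closure H → g.IsSurfaceGravity (ζ : SmoothVF n M) S (fun _ ↦ κ ζ) :=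
    fun ζ S hS hSH q hq ↦ LorentzianMetric.isGravityAt_self_iff.1
      (LorentzianMetric.isGravityAt_self hξ hp hξ0 hκ hrank ζ (hS.subset hSH hq) (hS.ne_zero q hq))
  let A : LieSubalgebra ℝ (SmoothVF n M) :=
    { g.normalKilling H with
      lie_mem' := fun {ξ η} hξ hη ↦ by
        change ⁅ξ, η⁆ ∈ g.normalKilling H
        rw [hlie ⟨ξ, hξ⟩ ⟨η, hη⟩]
        exact sub_mem (Submodule.smul_mem _ _ hξ) (Submodule.smul_mem _ _ hη) }
  -- By the bracket formula, the kernel of `κ` is an Abelian subalgebra.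
  let D : Submodule ℝ (SmoothVF n M) := (LinearMap.ker κ).map (g.normalKilling H).subtype
  have hD : ∀ ζ : g.normalKilling H, (ζ : SmoothVF n M) ∈ D ↔ κ ζ = 0 := fun ζ ↦ by simp [D]
  have hDA : D ≤ g.normalKilling H := Submodule.map_subtype_le _ _
  have hDlie : ∀ {ξ η}, ξ ∈ D → η ∈ D → ⁅ξ, η⁆ = 0 := fun {ξ η} hξ hη ↦ by
    rw [hlie ⟨ξ, hDA hξ⟩ ⟨η, hDA hη⟩, (hD ⟨ξ, hDA hξ⟩).1 hξ, (hD ⟨η, hDA hη⟩).1 hη]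
    simp
  let Adeg : LieSubalgebra ℝ (SmoothVF n M) :=
    { D with
      lie_mem' := fun {ξ η} hξ hη ↦ by
        change ⁅ξ, η⁆ ∈ D
        rw [hDlie hξ hη]
        exact zero_mem D }
  have hAset : (A : Set (SmoothVF n M)) = g.horizonKillingSet H :=
    (LorentzianMetric.horizonKillingSet_eq hHnull.1 hconn).symm
  have hDrank : Module.finrank ℝ D = Module.finrank ℝ (LinearMap.ker κ) :=
    Submodule.finrank_map_subtype_eq _ _
  have hrn := κ.finrank_range_add_finrank_ker
  have hr1 : Module.finrank ℝ (LinearMap.range κ) ≤ 1 := by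
    simpa using Submodule.finrank_le (LinearMap.range κ)
  refine ⟨A, Adeg, κ, hAset, hfin, hrank, hgrav, ?_, hDA, ⟨fun ξ η ↦ Subtype.ext (hDlie ξ.2 η.2)⟩,
    ?_, hD, fun h ↦ ?_, fun _ ξ hξ ↦ ⟨mt (hD ξ).2 hξ, fun η hη ↦ ?_⟩, fun ξ hξ ζ ↦ ?_⟩
  · ext ζ
    constructor
    · intro hζ
      by_cases hζ0 : ζ = 0
      · exact Or.inl hζ0
      · obtain ⟨T, hT, hTH⟩ := LorentzianMetric.exists_isKillingHorizon hHnull.1 hconn (hDA hζ) hζ0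
        refine Or.inr ⟨T, hT, hTH, fun q hq v ↦ ?_⟩
        have := hgrav ⟨ζ, hDA hζ⟩ T hT hTH q hq v
        rwa [(hD ⟨ζ, hDA hζ⟩).1 hζ] at this
    · rintro (rfl | ⟨T, hT, hTH, hT0⟩)
      · exact zero_mem D
      · obtain ⟨q, hq⟩ := hT.nonempty
        have hζ := hT.mem_normalKilling hTH
        refine (hD ⟨ζ, hζ⟩).2 ?_
        exact LorentzianMetric.IsGravityAt.unique (hT.ne_zero q hq)
          (LorentzianMetric.isGravityAt_self_iff.2 (hgrav ⟨ζ, hζ⟩ T hT hTH q hq))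
          (LorentzianMetric.isGravityAt_self_iff.2 (hT0 q hq))
  · change Module.finrank ℝ (g.normalKilling H) - 1 ≤ Module.finrank ℝ D
    omega
  · -- As `m ≥ 2`, the dimensions `m - 1` and `m` differ.
    by_contra! hall
    have h1 : Module.finrank ℝ D = Module.finrank ℝ (g.normalKilling H) - 1 := h
    have h2 : D = g.normalKilling H := le_antisymm hDA fun ζ hζ ↦ hall ⟨ζ, hζ⟩
    rw [h2] at h1
    omega
  · have h1 := hlie ξ ⟨η, hDA hη⟩
    rw [(hD ⟨η, hDA hη⟩).1 hη, zero_smul, zero_sub, ← neg_smul] at h1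
    exact h1
  · have hc : ∀ c : ℝ, κ ζ = c * κ ξ ↔ c = κ ζ / κ ξ := fun c ↦ by
      rw [eq_div_iff hξ, eq_comm]
    refine ⟨κ ζ / κ ξ, ⟨(hD _).2 ?_, (hc _).2 rfl⟩, fun c h ↦ (hc c).1 h.2⟩
    rw [map_sub, map_smul, smul_eq_mul, div_mul_cancel₀ _ hξ, sub_self]
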